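/- Let $K\ge 1$, let $\Omega_K=\{1,\dots,K,\varpi\}$, where $\varpi$ stands for all sizes greater than $K$, and let $F\subseteq\Omega_K^4$. For a graph $G$ on $[n]$ and a vertex $v$, let $c_G(v)$ be the size of the component of $v$ in $G$ if this is at most $K$, and $c_G(v)=\varpi$ otherwise; for $\vec v=(v_1,\dots,v_4)\in[n]^4$ put $c_G(\vec v)=(c_G(v_1),\dots,c_G(v_4))$. *The process.* For $n\ge 1$ let $\mathcal P_{\vec v}$, $\vec v\in[n]^4$, be independent Poisson processes of rate $1/(2n^3)$. The process $\mathbf{BSR}^{(n)}(t)$, $t\ge 0$, starts at the empty graph on $[n]$ and changes only at the points of these processes: at a point $t$ of $\mathcal P_{\vec v}$ the edge $(v_1,v_2)$ is added if $c_{\mathbf{BSR}^{(n)}(t-)}(\vec v)\in F$, and the edge $(v_3,v_4)$ is added otherwise. For $i\in\Omega_K$ let $\bar x_i(t)=\frac1n\,|\{v\in[n]: c_{\mathbf{BSR}^{(n)}(t)}(v)=i\}|$. *The differential equations.* Add elements of $\Omega_K$ with the conventions that a sum greater than $K$ is $\varpi$ and that $j+\varpi=\varpi+j=\varpi$. For $a,b\in\Omega_K$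 let $$\Delta(a,b;i)=i\,(\mathbf 1_{\{a+b=i\}}-\mathbf 1_{\{a=i\}}-\mathbf 1_{\{b=i\}})\quad(1\le i\le K),\qquad \Delta(a,b;\varpi)=\mathbf 1_{\{a+b=\varpi\}}\,(a\mathbf 1_{\{a\le K\}}+b\mathbf 1_{\{b\le K\}}),$$ and for $\vec j=(j_1,\dots,j_4)\in\Omega_K^4$ let $\Delta(\vec j;i)=\Delta(j_1,j_2;i)$ if $\vec j\in F$ and $\Delta(\vec j;i)=\Delta(j_3,j_4;i)$ if $\vec j\notin F$. Consider the system $$x_i'(t)=\frac12\sum_{\vec j\in\Omega_K^4}\Delta(\vec j;i)\,x_{j_1}(t)x_{j_2}(t)x_{j_3}(t)x_{j_4}(t),\quad i\in\Omega_K,\ t\ge 0,\qquad x_1(0)=1,\quad x_i(0)=0\ (i\ne 1).$$ *Lemma.* This system has a unique solution $x=(x_i)_{i\in\Omega_K}$ on $[0,\infty)$. For every $\delta\in(0,1/2)$ and $T>0$ there exist $C_1,C_2\in(0,\infty)$ (depending only on $K,F,\delta,T$) such that for all $n\ge 1$ $$\mathbb P\Big(\sup_{i\in\Omega_K}\ \sup_{t\in[0,T]}|\bar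 x_i(t)-x_i(t)|>n^{-\delta}\Big)<C_1\exp\left(-C_2\,n^{1-2\delta}\right).$$ -/

import Mathlib

open MeasureTheory ProbabilityTheory Set
open scoped NNReal

namespace BoundedSize

/-- The set `Ω_K = {1, …, K, ϖ}`: `some a` stands for the size `a + 1` (`a : Fin K`), and `none`
stands for `ϖ`, that is, for all sizes greater than `K`. -/
abbrev SizeClass (K : ℕ) : Type := Option (Fin K)

/-- The element of `Ω_K` that a component with `m ≥ 1` vertices belongs to. -/
def sizeClass (K m : ℕ) : SizeClass K :=
  if h : 1 ≤ m ∧ m ≤ K then some ⟨m - 1, by omega⟩ else none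

/-- Addition on `Ω_K`: a sum greater than `K` is `ϖ`, and `ϖ + j = j + ϖ = ϖ`. -/
def classAdd {K : ℕ} : SizeClass K → SizeClass K → SizeClass K
  | some a, some b => sizeClass K ((a + 1) + (b + 1))
  | _, _ => none

/-- `j · 1{j ≤ K}` for `j ∈ Ω_K`. -/
def smallSize {K : ℕ} : SizeClass K → ℝ
  | some a => (a : ℝ) + 1
  | none => 0

/-- The change of the number of vertices in components of class `i` when two distinct components
of classes `a` and `b` are merged. -/
def pairDelta {K : ℕ} (a b : SizeClass K) : SizeClass K → ℝ
  | some k => ((k : ℝ) + 1) * ((if classAdd a b = some k then 1 else 0)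
      - (if a = some k then 1 else 0) - (if b = some k then 1 else 0))
  | none => if classAdd a b = none then smallSize a + smallSize b else 0

/-- `Δ(j; i)` for the rule `F ⊆ Ω_K⁴`. -/
def delta {K : ℕ} (F : Finset (Fin 4 → SizeClass K)) (j : Fin 4 → SizeClass K)
    (i : SizeClass K) : ℝ :=
  if j ∈ F then pairDelta (j 0) (j 1) i else pairDelta (j 2) (j 3) i

/-- The polynomial vector field of the limiting system of differential equations. -/
noncomputable def drift {K : ℕ} (F : Finset (Fin 4 → SizeClass K)) (x : SizeClass K → ℝ)
    (i : SizeClass K) : ℝ :=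
  (1 / 2) * ∑ j ∈ F, delta F j i * (x (j 0) * x (j 1) * x (j 2) * x (j 3)) +
  (1 / 2) * ∑ j ∈ Fᶜ, delta F j i * (x (j 0) * x (j 1) * x (j 2) * x (j 3))

/-- `x` solves `x_i' = F_i(x)` on `[0, ∞)` (with the one-sided derivative at `0`), with
`x_1(0) = 1` and all other coordinates `0` at time `0`. -/
structure IsODESolution {K : ℕ} (F : Finset (Fin 4 → SizeClass K))
    (x : ℝ → SizeClass K → ℝ) : Prop where
  init : ∀ i, x 0 i = if i = sizeClass K 1 then 1 else 0
  deriv : ∀ t, 0 ≤ t → ∀ i, HasDerivWithinAt (fun s => x s i) (drift F (x t) i) (Ici 0) t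

/-- `N` is (the counting process of) a homogeneous Poisson process on `[0, ∞)` of rate `r`. -/
structure IsPoissonProcess {Ω : Type*} [MeasurableSpace Ω] (N : ℝ≥0 → Ω → ℕ) (r : ℝ≥0)
    (μ : Measure Ω) : Prop where
  measurable : ∀ t, Measurable (N t)
  zero : ∀ᵐ ω ∂μ, N 0 ω = 0
  monotone : ∀ᵐ ω ∂μ, Monotone fun t => N t ω
  rightContinuous : ∀ᵐ ω ∂μ, ∀ t, ContinuousWithinAt (fun s => N s ω) (Ici t) t
  indepIncrements : HasIndepIncrements N μ
  law : ∀ s t, s ≤ t → HasLaw (fun ω => N t ω - N s ω) (poissonMeasure (r * (t - s))) μ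

variable {n : ℕ}

/-- `c_G(v)`: the class in `Ω_K` of the component of `G` that contains `v`. -/
noncomputable def vertexClass (K : ℕ) (G : SimpleGraph (Fin n)) (v : Fin n) : SizeClass K :=
  sizeClass K (G.connectedComponentMk v).supp.ncard

open Classical in
/-- One round of the rule with the quadruple `v`: the edge `(v₁, v₂)` is added if
`c_G(v) ∈ F`, and the edge `(v₃, v₄)` otherwise. (`SimpleGraph.edge u u` is empty, so that a loop
has no effect.) -/
noncomputable def step {K : ℕ} (F : Finset (Fin 4 → SizeClass K)) (G : SimpleGraph (Fin n))
    (v : Fin 4 → Fin n) : SimpleGraph (Fin n) :=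
  if (fun k => vertexClass K G (v k)) ∈ F then G ⊔ SimpleGraph.edge (v 0) (v 1)
  else G ⊔ SimpleGraph.edge (v 2) (v 3)

/-- The path `G` is driven by the counting paths `N v`, `v ∈ [n]⁴`: it starts from the empty
graph, it does not change over a time interval `(s, t]` without points, and if `(s, t]` contains
exactly one point, and this belongs to the quadruple `v`, then one round with `v` is performed. -/
structure IsBSRPath {K : ℕ} (F : Finset (Fin 4 → SizeClass K))
    (N : (Fin 4 → Fin n) → ℝ≥0 → ℕ) (G : ℝ≥0 → SimpleGraph (Fin n)) : Prop where
  init : G 0 = ⊥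
  const : ∀ s t, s ≤ t → (∀ w, N w t = N w s) → G t = G s
  jump : ∀ s t, s ≤ t → ∀ v, N v t = N v s + 1 → (∀ w, w ≠ v → N w t = N w s) →
    G t = step F (G s) v

/-- `G` is the continuous-time bounded-size rule process of the rule `F`, driven by independent
Poisson processes `N v` of rate `1 / (2 n³)`, one for each quadruple `v ∈ [n]⁴`. -/
structure IsBSRProcess {K : ℕ} (F : Finset (Fin 4 → SizeClass K)) {Ω : Type*}
    [MeasurableSpace Ω] (μ : Measure Ω) (N : (Fin 4 → Fin n) → ℝ≥0 → Ω → ℕ)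
    (G : ℝ≥0 → Ω → SimpleGraph (Fin n)) : Prop where
  poisson : ∀ v, IsPoissonProcess (N v) (1 / (2 * (n : ℝ≥0) ^ 3)) μ
  indep : iIndepFun (fun v ω t => N v t ω) μ
  path : ∀ᵐ ω ∂μ, IsBSRPath F (fun v t => N v t ω) (fun t => G t ω)

/-- The proportion of vertices of `G` in components of class `i`. -/
noncomputable def density (K : ℕ) (G : SimpleGraph (Fin n)) (i : SizeClass K) : ℝ :=
  ({v : Fin n | vertexClass K G v = i}.ncard : ℝ) / n

end BoundedSize

/-!
Time is discretized. On a grid of mesh `h` the numbers of points of the driving Poisson processes in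
the intervals of the grid are independent, and with probability `1 - O(h)` no interval up to time
`T` contains two points. On that event the process, observed on the grid, is a chain of graphs
driven by independent identically distributed inputs (`IsBSRPath.eq_orbit`,
`measureReal_uniquePoint_le_sum`), and between two points of the grid it takes no further values.
The number `n` of vertices is fixed while `h` is sent to `0`, so no error coming from the
discretization matters in the end.

For this chain the argument is the differential equation method. Merging two distinct components
of classes `a` and `b` changes the number of vertices of class `i` by `pairDelta a b i`
(`density_sup_edge_of_not_reachable`), and an edge inside a component changes nothing. A component
of class `ϖ` may be arbitrarily large, but `pairDelta ϖ ϖ = 0`, so only edges inside one of the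
small components make the exact drift of the densities differ from the polynomial field `drift`,
and there are few of these: the two drifts differ by `O(1 / n)`
(`abs_sum_density_step_sub_le`). The densities jump by `O(1 / n)` at a total rate of `n / 2`, hence
the exponential supermartingale of their compensated sums shows that the noise stays below `ε` up to
time `T`, outside an event of probability of order `exp (-c n ε ^ 2)`
(`sum_exists_compensated_gt_le`); the maximal inequality behind it (`sum_visits_le`) is proved by
conditioning on the first input and induction on the number of steps. Grönwall's inequality
(`norm_sub_le_of_perturbed_euler`) turns small noise into closeness to the solution, and
`ε` of order `n ^ (-δ)` gives the bound once `n` is so large that the error `O(1 / n)` is below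
`n ^ (-δ)`. Smaller `n` are absorbed by the constant `C₁`.

The solution exists for all times because it stays in the simplex (`exists_isODESolution`): the
field sums to `0`, and its `i`-th coordinate is nonnegative where `x i = 0`.
-/

namespace BoundedSize

section

/-! ### Adding one edge to a graph -/

lemma reachable_sup_edge_iff {V : Type*} (G : SimpleGraph V) (u v x y : V) :
    (G ⊔ SimpleGraph.edge u v).Reachable x y ↔
      G.Reachable x y ∨ (G.Reachable x u ∧ G.Reachable v y) ∨
        (G.Reachable x v ∧ G.Reachable u y) := by
  have hle : G ≤ G ⊔ SimpleGraph.edge u v := le_sup_left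
  have huv : (G ⊔ SimpleGraph.edge u v).Reachable u v := by
    by_cases h : u = v
    · subst h; exact SimpleGraph.Reachable.refl _
    · refine SimpleGraph.Adj.reachable ?_
      rw [SimpleGraph.sup_adj, SimpleGraph.edge_adj]
      exact Or.inr ⟨Or.inl ⟨rfl, rfl⟩, h⟩
  constructor
  · rintro ⟨p⟩
    induction p with
    | nil => exact Or.inl (SimpleGraph.Reachable.refl _)
    | @cons a b c hab p ih =>
      rw [SimpleGraph.sup_adj, SimpleGraph.edge_adj] at hab
      rcases hab with hab | ⟨⟨rfl, rfl⟩ | ⟨rfl, rfl⟩, -⟩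
      · have := hab.reachable
        rcases ih with h | ⟨h, h'⟩ | ⟨h, h'⟩
        · exact Or.inl (this.trans h)
        · exact Or.inr (Or.inl ⟨this.trans h, h'⟩)
        · exact Or.inr (Or.inr ⟨this.trans h, h'⟩)
      · have := SimpleGraph.Reachable.refl (G := G) a
        rcases ih with h | ⟨h, h'⟩ | ⟨h, h'⟩
        · exact Or.inr (Or.inl ⟨this, h⟩)
        · exact Or.inr (Or.inl ⟨this, h'⟩)
        · exact Or.inl h'
      · have := SimpleGraph.Reachable.refl (G := G) a
        rcases ih with h | ⟨h, h'⟩ | ⟨h, h'⟩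
        · exact Or.inr (Or.inr ⟨this, h⟩)
        · exact Or.inl h'
        · exact Or.inr (Or.inr ⟨this, h'⟩)
  · rintro (h | ⟨h, h'⟩ | ⟨h, h'⟩)
    · exact h.mono hle
    · exact (h.mono hle).trans (huv.trans (h'.mono hle))
    · exact (h.mono hle).trans (huv.symm.trans (h'.mono hle))

variable {K n : ℕ}

lemma sizeClass_eq_some_iff {m : ℕ} {k : Fin K} :
    sizeClass K m = some k ↔ m = k + 1 := by
  unfold sizeClass
  split_ifs with h
  · simp only [Option.some.injEq, Fin.ext_iff]; omega
  · have := k.2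
    simp; omega

lemma sizeClass_eq_none_iff {m : ℕ} (hm : 1 ≤ m) : sizeClass K m = none ↔ K < m := by
  unfold sizeClass
  split_ifs with h <;> simp <;> omega

lemma classAdd_sizeClass {α β : ℕ} (hα : 1 ≤ α) (hβ : 1 ≤ β) :
    classAdd (sizeClass K α) (sizeClass K β) = sizeClass K (α + β) := by
  have hnone : K < α + β → sizeClass K (α + β) = none :=
    (sizeClass_eq_none_iff (by omega)).2
  cases ha : sizeClass K α with
  | none => rw [sizeClass_eq_none_iff hα] at ha; rw [hnone (by omega)]; rfl
  | some a =>
    cases hb : sizeClass K β with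
    | none => rw [sizeClass_eq_none_iff hβ] at hb; rw [hnone (by omega)]; rfl
    | some b =>
      rw [sizeClass_eq_some_iff] at ha hb
      simp only [classAdd, ha, hb]

/-- `pairDelta` counts what it should: if components with `α` and `β` vertices are merged, then
each of the `α + β` vertices leaves its old class and enters the class of size `α + β`. -/
lemma pairDelta_sizeClass {α β : ℕ} (hα : 1 ≤ α) (hβ : 1 ≤ β) (i : SizeClass K) :
    (α : ℝ) * ((if sizeClass K (α + β) = i then 1 else 0) - if sizeClass K α = i then 1 else 0) +
      β * ((if sizeClass K (α + β) = i then 1 else 0) - if sizeClass K β = i then 1 else 0) =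
      pairDelta (sizeClass K α) (sizeClass K β) i := by
  cases i with
  | some k =>
    simp only [pairDelta, classAdd_sizeClass hα hβ]
    have e1 : ∀ m : ℕ, (m : ℝ) * (if sizeClass K m = some k then 1 else 0) =
        ((k : ℝ) + 1) * (if sizeClass K m = some k then 1 else 0) := by
      intro m
      split_ifs with h
      · rw [sizeClass_eq_some_iff] at h; subst h; push_cast; ring
      · simp
    have h1 := e1 (α + β); have h2 := e1 α; have h3 := e1 β
    push_cast at h1
    linarith
  | none =>
    simp only [pairDelta, classAdd_sizeClass hα hβ, sizeClass_eq_none_iff hα,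
      sizeClass_eq_none_iff hβ, sizeClass_eq_none_iff (show 1 ≤ α + β by omega)]
    have e1 : ∀ m : ℕ, 1 ≤ m → smallSize (sizeClass K m) = if K < m then 0 else (m : ℝ) := by
      intro m hm
      cases h : sizeClass K m with
      | none => rw [sizeClass_eq_none_iff hm] at h; simp [smallSize, h]
      | some k =>
        rw [sizeClass_eq_some_iff] at h
        have := k.2
        rw [if_neg (by omega), h]; simp [smallSize]
    rw [e1 α hα, e1 β hβ]
    by_cases h : K < α + β
    · simp only [h, if_true]
      split_ifs <;> ring
    · rw [if_neg h, if_neg h, if_neg (by omega), if_neg (by omega)]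
      ring

open Classical in
lemma natCast_mul_density (hn : 1 ≤ n) (G : SimpleGraph (Fin n)) (i : SizeClass K) :
    (n : ℝ) * density K G i = ∑ w, if vertexClass K G w = i then (1 : ℝ) else 0 := by
  have : (n : ℝ) ≠ 0 := by positivity
  rw [density, mul_div_cancel₀ _ this, Set.ncard_eq_toFinset_card', Finset.sum_boole]
  congr 2
  ext; simp

lemma mem_supp_iff (G : SimpleGraph (Fin n)) (u w : Fin n) :
    w ∈ (G.connectedComponentMk u).supp ↔ G.Reachable w u := by
  rw [SimpleGraph.ConnectedComponent.mem_supp_iff, SimpleGraph.ConnectedComponent.eq]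

lemma one_le_ncard_supp (G : SimpleGraph (Fin n)) (u : Fin n) :
    1 ≤ (G.connectedComponentMk u).supp.ncard :=
  (Set.ncard_pos (Set.toFinite _)).2 ⟨u, (mem_supp_iff G u u).2 (.refl _)⟩

lemma vertexClass_congr {G H : SimpleGraph (Fin n)} {u v : Fin n}
    (h : ∀ w, G.Reachable w u ↔ H.Reachable w v) : vertexClass K G u = vertexClass K H v := by
  unfold vertexClass
  congr 2
  ext w
  rw [mem_supp_iff, mem_supp_iff, h]

lemma density_sup_edge_of_reachable {G : SimpleGraph (Fin n)} {u v : Fin n}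
    (h : G.Reachable u v) : density K (G ⊔ SimpleGraph.edge u v) = density K G := by
  have hc : ∀ w, vertexClass K (G ⊔ SimpleGraph.edge u v) w = vertexClass K G w := by
    refine fun w => vertexClass_congr fun x => ?_
    rw [reachable_sup_edge_iff]
    refine ⟨?_, Or.inl⟩
    rintro (h1 | ⟨h1, h2⟩ | ⟨h1, h2⟩)
    · exact h1
    · exact h1.trans (h.trans h2)
    · exact h1.trans (h.symm.trans h2)
  funext i
  simp only [density, hc]

open Classical in
lemma density_sup_edge_of_not_reachable (hn : 1 ≤ n) {G : SimpleGraph (Fin n)} {u v : Fin n}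
    (h : ¬ G.Reachable u v) (i : SizeClass K) :
    n * (density K (G ⊔ SimpleGraph.edge u v) i - density K G i) =
      pairDelta (vertexClass K G u) (vertexClass K G v) i := by
  set A := (G.connectedComponentMk u).supp with hA
  set B := (G.connectedComponentMk v).supp with hB
  set c := sizeClass K (A.ncard + B.ncard) with hcdef
  have hAB : Disjoint A B := by
    rw [Set.disjoint_left]
    intro w hw hw'
    rw [mem_supp_iff] at hw hw'
    exact h (hw.symm.trans hw')
  -- all vertices of the two old components lie in the new one, whose vertex set is `A ∪ B`
  have hnew : ∀ w, w ∈ A ∪ B → vertexClass K (G ⊔ SimpleGraph.edge u v) w = c := by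
    intro w hw
    unfold vertexClass
    rw [hcdef, ← Set.ncard_union_eq hAB (Set.toFinite _) (Set.toFinite _)]
    congr 2
    ext x
    rw [Set.mem_union, mem_supp_iff, mem_supp_iff, mem_supp_iff, reachable_sup_edge_iff]
    rw [Set.mem_union, mem_supp_iff, mem_supp_iff] at hw
    rcases hw with hw | hw
    · refine ⟨?_, ?_⟩
      · rintro (h1 | ⟨h1, h2⟩ | ⟨h1, h2⟩)
        · exact Or.inl (h1.trans hw)
        · exact Or.inl h1
        · exact Or.inr h1
      · rintro (h1 | h1)
        · exact Or.inl (h1.trans hw.symm)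
        · exact Or.inr (Or.inr ⟨h1, hw.symm⟩)
    · refine ⟨?_, ?_⟩
      · rintro (h1 | ⟨h1, h2⟩ | ⟨h1, h2⟩)
        · exact Or.inr (h1.trans hw)
        · exact Or.inl h1
        · exact Or.inr h1
      · rintro (h1 | h1)
        · exact Or.inr (Or.inl ⟨h1, hw.symm⟩)
        · exact Or.inl (h1.trans hw.symm)
  have hold : ∀ w, w ∉ A ∪ B →
      vertexClass K (G ⊔ SimpleGraph.edge u v) w = vertexClass K G w := by
    intro w hw
    rw [Set.mem_union, mem_supp_iff, mem_supp_iff, not_or] at hw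
    refine vertexClass_congr fun x => ?_
    rw [reachable_sup_edge_iff]
    refine ⟨?_, Or.inl⟩
    rintro (h1 | ⟨h1, h2⟩ | ⟨h1, h2⟩)
    · exact h1
    · exact (hw.2 h2.symm).elim
    · exact (hw.1 h2.symm).elim
  have hAc : ∀ w ∈ A, vertexClass K G w = sizeClass K A.ncard := by
    intro w hw
    rw [hA, SimpleGraph.ConnectedComponent.mem_supp_iff] at hw
    rw [vertexClass, hw, hA]
  have hBc : ∀ w ∈ B, vertexClass K G w = sizeClass K B.ncard := by
    intro w hw
    rw [hB, SimpleGraph.ConnectedComponent.mem_supp_iff] at hw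
    rw [vertexClass, hw, hB]
  have hpt : ∀ w, (if vertexClass K (G ⊔ SimpleGraph.edge u v) w = i then (1 : ℝ) else 0) -
      (if vertexClass K G w = i then 1 else 0) =
      (if w ∈ A then 1 else 0) *
        ((if c = i then 1 else 0) - if sizeClass K A.ncard = i then 1 else 0) +
      (if w ∈ B then 1 else 0) *
        ((if c = i then 1 else 0) - if sizeClass K B.ncard = i then 1 else 0) := by
    intro w
    by_cases hwA : w ∈ A
    · have hwB : w ∉ B := Set.disjoint_left.1 hAB hwA
      rw [hnew w (Or.inl hwA), hAc w hwA]; simp [hwA, hwB]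
    · by_cases hwB : w ∈ B
      · rw [hnew w (Or.inr hwB), hBc w hwB]; simp [hwA, hwB]
      · rw [hold w (by simp [hwA, hwB])]; simp [hwA, hwB]
  have hcard : ∀ (S : Set (Fin n)) [DecidablePred (· ∈ S)],
      ∑ w, (if w ∈ S then (1 : ℝ) else 0) = S.ncard := by
    intro S _
    rw [Set.ncard_eq_toFinset_card', Finset.sum_boole]
    congr 2
    ext; simp
  rw [mul_sub, natCast_mul_density hn, natCast_mul_density hn, ← Finset.sum_sub_distrib,
    Finset.sum_congr rfl fun w _ => hpt w, Finset.sum_add_distrib, ← Finset.sum_mul,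
    ← Finset.sum_mul, hcard, hcard, hcdef,
    pairDelta_sizeClass (one_le_ncard_supp G u) (one_le_ncard_supp G v)]
  rfl

lemma density_nonneg (G : SimpleGraph (Fin n)) (i : SizeClass K) : 0 ≤ density K G i := by
  unfold density; positivity

lemma density_le_one (G : SimpleGraph (Fin n)) (i : SizeClass K) : density K G i ≤ 1 := by
  unfold density
  refine div_le_one_of_le₀ ?_ (by positivity)
  have := Set.ncard_le_card ({v : Fin n | vertexClass K G v = i})
  rw [Nat.card_fin] at this
  exact_mod_cast this

end

section

/-! ### The vector field of the limiting equations -/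

variable {K n : ℕ}

lemma smallSize_nonneg (a : SizeClass K) : 0 ≤ smallSize a := by
  cases a <;> simp only [smallSize] <;> positivity

lemma smallSize_le (a : SizeClass K) : smallSize a ≤ K := by
  cases a with
  | none => simp [smallSize]
  | some a =>
    have := a.2
    simp only [smallSize]
    exact_mod_cast this

lemma abs_pairDelta_le (a b i : SizeClass K) : |pairDelta a b i| ≤ 2 * K := by
  cases i with
  | some k =>
    have hk : (k : ℝ) + 1 ≤ K := by exact_mod_cast k.2
    have hk0 : (0 : ℝ) ≤ k := by positivity
    simp only [pairDelta]
    rw [abs_mul, abs_of_nonneg (by positivity), mul_comm]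
    refine mul_le_mul ?_ hk (by positivity) (by norm_num)
    split_ifs <;> norm_num
  | none =>
    have := smallSize_nonneg a; have := smallSize_nonneg b
    have := smallSize_le a; have := smallSize_le b
    simp only [pairDelta]
    split_ifs
    · rw [abs_of_nonneg (by positivity)]; linarith
    · simp

lemma pairDelta_none_none (i : SizeClass K) : pairDelta none none i = 0 := by
  cases i <;> simp [pairDelta, classAdd, smallSize]

/-- Merging components does not change the number of vertices. -/
lemma sum_pairDelta (a b : SizeClass K) : ∑ i, pairDelta a b i = 0 := by
  have h : ∀ c : SizeClass K,
      ∑ k : Fin K, ((k : ℝ) + 1) * (if c = some k then 1 else 0) = smallSize c := by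
    intro c
    cases c with
    | none => simp [smallSize]
    | some a => simp [smallSize]
  have hab : smallSize (classAdd a b) + (if classAdd a b = none then smallSize a + smallSize b
      else 0) = smallSize a + smallSize b := by
    cases hc : classAdd a b with
    | none => simp [smallSize]
    | some c =>
      cases a with
      | none => simp [classAdd] at hc
      | some a =>
        cases b with
        | none => simp [classAdd] at hc
        | some b =>
          simp only [classAdd] at hc
          rw [sizeClass_eq_some_iff] at hc
          have : ((a : ℕ) : ℝ) + 1 + ((b : ℕ) + 1) = (c : ℕ) + 1 := by exact_mod_cast hc
          simp only [smallSize]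
          simp; linarith
  rw [Fintype.sum_option]
  simp only [pairDelta, mul_sub, Finset.sum_sub_distrib, h]
  linarith

lemma pairDelta_nonneg {a b i : SizeClass K} (ha : a ≠ i) (hb : b ≠ i) :
    0 ≤ pairDelta a b i := by
  cases i with
  | some k =>
    simp only [pairDelta, if_neg ha, if_neg hb]
    split_ifs <;> simp; positivity
  | none =>
    have := smallSize_nonneg a; have := smallSize_nonneg b
    simp only [pairDelta]
    split_ifs <;> positivity

variable (F : Finset (Fin 4 → SizeClass K))

lemma drift_eq (x : SizeClass K → ℝ) (i : SizeClass K) :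
    drift F x i = 1 / 2 * ∑ j, delta F j i * ∏ l, x (j l) := by
  rw [drift, ← mul_add, Finset.sum_add_sum_compl]
  simp [Fin.prod_univ_four]

lemma sum_drift (x : SizeClass K → ℝ) : ∑ i, drift F x i = 0 := by
  have h : ∀ j, ∑ i, delta F j i = 0 := by
    intro j
    unfold delta
    split_ifs <;> exact sum_pairDelta _ _
  simp_rw [drift_eq]
  rw [← Finset.mul_sum, Finset.sum_comm]
  simp_rw [← Finset.sum_mul, h]
  simp

lemma drift_nonneg {x : SizeClass K → ℝ} (hx : ∀ i, 0 ≤ x i) {i : SizeClass K} (hi : x i = 0) :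
    0 ≤ drift F x i := by
  rw [drift_eq]
  refine mul_nonneg (by norm_num) (Finset.sum_nonneg fun j _ => ?_)
  by_cases h : ∃ l, j l = i
  · obtain ⟨l, hl⟩ := h
    rw [Finset.prod_eq_zero (Finset.mem_univ l) (by rw [hl, hi]), mul_zero]
  · push Not at h
    refine mul_nonneg ?_ (Finset.prod_nonneg fun l _ => hx _)
    unfold delta
    split_ifs <;> exact pairDelta_nonneg (h _) (h _)

lemma contDiff_drift : ContDiff ℝ 1 (drift F) := by
  rw [contDiff_pi]
  intro i
  unfold drift
  fun_prop

lemma exists_lipschitzOnWith_drift {S : Set (SizeClass K → ℝ)} (hS : IsCompact S) :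
    ∃ L : ℝ≥0, LipschitzOnWith L (drift F) S :=
  ((contDiff_drift F).locallyLipschitz.locallyLipschitzOn).exists_lipschitzOnWith_of_compact hS

lemma exists_norm_drift_le {S : Set (SizeClass K → ℝ)} (hS : IsCompact S) :
    ∃ B : ℝ≥0, ∀ x ∈ S, ‖drift F x‖ ≤ B := by
  obtain ⟨B, hB⟩ := hS.exists_bound_of_continuousOn (contDiff_drift F).continuous.continuousOn
  exact ⟨B.toNNReal, fun x hx => (hB x hx).trans (Real.le_coe_toNNReal B)⟩

/-! ### The drift of the graph process -/

lemma sum_delta_vertexClass (hn : 1 ≤ n) (G : SimpleGraph (Fin n)) (i : SizeClass K) :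
    ∑ v : Fin 4 → Fin n, delta F (fun k => vertexClass K G (v k)) i =
      2 * (n : ℝ) ^ 4 * drift F (density K G) i := by
  classical
  have hn0 : (n : ℝ) ≠ 0 := by positivity
  have hcard : ∀ j : Fin 4 → SizeClass K,
      (({v : Fin 4 → Fin n | (fun k => vertexClass K G (v k)) = j} : Finset _).card : ℝ) =
        (n : ℝ) ^ 4 * ∏ l, density K G (j l) := by
    intro j
    have : ({v : Fin 4 → Fin n | (fun k => vertexClass K G (v k)) = j} : Finset _) =
        Fintype.piFinset fun l => ({w | vertexClass K G w = j l} : Finset (Fin n)) := by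
      ext v; simp [funext_iff]
    have h4 : (n : ℝ) ^ 4 * ∏ l, density K G (j l) = ∏ l, ((n : ℝ) * density K G (j l)) := by
      rw [Finset.prod_mul_distrib]; simp
    rw [this, Fintype.card_piFinset, h4]
    push_cast
    refine Finset.prod_congr rfl fun l _ => ?_
    rw [natCast_mul_density hn, Finset.sum_boole]
  rw [← Finset.sum_fiberwise_of_maps_to (t := Finset.univ)
    (g := fun v k => vertexClass K G (v k)) (fun _ _ => Finset.mem_univ _), drift_eq,
    show ∀ y : ℝ, 2 * (n : ℝ) ^ 4 * (1 / 2 * y) = (n : ℝ) ^ 4 * y from fun y => by ring,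
    Finset.mul_sum]
  refine Finset.sum_congr rfl fun j _ => ?_
  rw [Finset.sum_congr rfl (g := fun _ => delta F j i)
    (fun v hv => by rw [(Finset.mem_filter.1 hv).2]), Finset.sum_const, nsmul_eq_mul, hcard]
  ring

/-- `u` and `v` lie in a common component of at most `K` vertices. -/
def SameSmall (K : ℕ) (G : SimpleGraph (Fin n)) (u v : Fin n) : Prop :=
  G.Reachable u v ∧ (G.connectedComponentMk u).supp.ncard ≤ K

open Classical in
lemma abs_density_sup_edge_sub_le (hn : 1 ≤ n) (G : SimpleGraph (Fin n)) (u v : Fin n)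
    (i : SizeClass K) :
    |n * (density K (G ⊔ SimpleGraph.edge u v) i - density K G i) -
      pairDelta (vertexClass K G u) (vertexClass K G v) i| ≤
      2 * K * if SameSmall K G u v then 1 else 0 := by
  by_cases h : G.Reachable u v
  · rw [density_sup_edge_of_reachable h, sub_self, mul_zero, zero_sub, abs_neg]
    by_cases hs : SameSmall K G u v
    · simpa [hs] using abs_pairDelta_le _ _ i
    · have hu : vertexClass K G u = none := by
        rw [vertexClass, sizeClass_eq_none_iff (one_le_ncard_supp G u)]
        by_contra hK
        exact hs ⟨h, not_lt.1 hK⟩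
      have hv : vertexClass K G v = none := by
        rw [← hu]
        exact vertexClass_congr fun w => ⟨fun hw => hw.trans h.symm, fun hw => hw.trans h⟩
      rw [hu, hv, pairDelta_none_none]
      simp [hs]
  · rw [density_sup_edge_of_not_reachable hn h, sub_self, abs_zero]
    positivity

lemma abs_density_sup_edge_le (hn : 1 ≤ n) (G : SimpleGraph (Fin n)) (u v : Fin n)
    (i : SizeClass K) :
    |density K (G ⊔ SimpleGraph.edge u v) i - density K G i| ≤ 2 * K / n := by
  have hn0 : (0 : ℝ) < n := by positivity
  by_cases h : G.Reachable u v
  · rw [density_sup_edge_of_reachable h, sub_self, abs_zero]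
    positivity
  · have := abs_pairDelta_le (vertexClass K G u) (vertexClass K G v) i
    rw [← density_sup_edge_of_not_reachable hn h, abs_mul, abs_of_pos hn0] at this
    rw [le_div_iff₀ hn0]
    linarith

lemma abs_density_step_le (hn : 1 ≤ n) (G : SimpleGraph (Fin n)) (v : Fin 4 → Fin n)
    (i : SizeClass K) : |density K (step F G v) i - density K G i| ≤ 2 * K / n := by
  unfold step
  split_ifs <;> exact abs_density_sup_edge_le hn G _ _ i

open Classical in
lemma card_sameSmall_le (G : SimpleGraph (Fin n)) :
    (({p : Fin n × Fin n | SameSmall K G p.1 p.2} : Finset _).card) ≤ n * K := by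
  refine (Finset.card_le_mul_card_image_of_maps_to (t := Finset.univ) (f := Prod.fst)
    (fun _ _ => Finset.mem_univ _) K ?_).trans (by simp [mul_comm])
  intro u _
  by_cases hu : (G.connectedComponentMk u).supp.ncard ≤ K
  · refine le_trans ?_ hu
    rw [Set.ncard_eq_toFinset_card']
    refine Finset.card_le_card_of_injOn Prod.snd ?_ ?_
    · intro p hp
      obtain ⟨hp1, hp2⟩ := Finset.mem_filter.1 (Finset.mem_coe.1 hp)
      have hp3 : SameSmall K G p.1 p.2 := (Finset.mem_filter.1 hp1).2
      rw [Set.coe_toFinset, mem_supp_iff, ← hp2]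
      exact hp3.1.symm
    · intro p hp q hq hpq
      have hp2 := (Finset.mem_filter.1 (Finset.mem_coe.1 hp)).2
      have hq2 := (Finset.mem_filter.1 (Finset.mem_coe.1 hq)).2
      exact Prod.ext (hp2.trans hq2.symm) hpq
  · rw [Finset.card_eq_zero.2]
    · positivity
    · refine Finset.eq_empty_of_forall_notMem fun p hp => ?_
      obtain ⟨hp1, rfl⟩ := Finset.mem_filter.1 hp
      exact hu (Finset.mem_filter.1 hp1).2.2

open Classical in
lemma sum_ite_sameSmall_le (G : SimpleGraph (Fin n)) {a b c d : Fin 4}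
    (hcover : ∀ l : Fin 4, l = a ∨ l = b ∨ l = c ∨ l = d) :
    ∑ v : Fin 4 → Fin n, (if SameSmall K G (v a) (v b) then (1 : ℝ) else 0) ≤
      K * (n : ℝ) ^ 3 := by
  rw [Finset.sum_boole]
  have : (({v : Fin 4 → Fin n | SameSmall K G (v a) (v b)} : Finset _).card) ≤
      (({p : Fin n × Fin n | SameSmall K G p.1 p.2} : Finset _) ×ˢ
        (Finset.univ : Finset (Fin n × Fin n))).card := by
    refine Finset.card_le_card_of_injOn (fun v => ((v a, v b), (v c, v d))) ?_ ?_
    · intro v hv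
      simpa using hv
    · intro v _ w _ hvw
      simp only [Prod.mk.injEq] at hvw
      funext l
      rcases hcover l with rfl | rfl | rfl | rfl
      exacts [hvw.1.1, hvw.1.2, hvw.2.1, hvw.2.2]
  have h2 := this.trans_eq (Finset.card_product _ _)
  have h3 := h2.trans (Nat.mul_le_mul_right _ (card_sameSmall_le G))
  simp only [Finset.card_univ, Fintype.card_prod, Fintype.card_fin] at h3
  calc _ ≤ ((n * K * (n * n) : ℕ) : ℝ) := by exact_mod_cast h3
    _ = _ := by push_cast; ring

/-- Only quadruples with two chosen vertices in one small component, of which there are few,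
distinguish the exact drift of the densities from the vector field of the limiting equations. -/
lemma abs_sum_density_step_sub_le (hn : 1 ≤ n) (G : SimpleGraph (Fin n)) (i : SizeClass K) :
    |∑ v : Fin 4 → Fin n, (density K (step F G v) i - density K G i) -
      2 * (n : ℝ) ^ 3 * drift F (density K G) i| ≤ 4 * K ^ 2 * (n : ℝ) ^ 2 := by
  classical
  have hn0 : (0 : ℝ) < n := by positivity
  have hpt : ∀ v : Fin 4 → Fin n,
      |n * (density K (step F G v) i - density K G i) -
        delta F (fun k => vertexClass K G (v k)) i| ≤
      2 * K * ((if SameSmall K G (v 0) (v 1) then 1 else 0) +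
        if SameSmall K G (v 2) (v 3) then 1 else 0) := by
    intro v
    have h0 := abs_density_sup_edge_sub_le hn G (v 0) (v 1) i
    have h1 := abs_density_sup_edge_sub_le hn G (v 2) (v 3) i
    unfold step delta
    rw [mul_add]
    by_cases hF : (fun k => vertexClass K G (v k)) ∈ F
    · rw [if_pos hF, if_pos hF]
      exact h0.trans (le_add_of_nonneg_right (by positivity))
    · rw [if_neg hF, if_neg hF]
      exact h1.trans (le_add_of_nonneg_left (by positivity))
  have hsum : |∑ v : Fin 4 → Fin n, (n * (density K (step F G v) i - density K G i) -
        delta F (fun k => vertexClass K G (v k)) i)| ≤ 4 * K ^ 2 * (n : ℝ) ^ 3 := by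
    refine (Finset.abs_sum_le_sum_abs _ _).trans ((Finset.sum_le_sum fun v _ => hpt v).trans ?_)
    rw [← Finset.mul_sum, Finset.sum_add_distrib]
    have h0 := sum_ite_sameSmall_le (K := K) G (a := 0) (b := 1) (c := 2) (d := 3) (by decide)
    have h1 := sum_ite_sameSmall_le (K := K) G (a := 2) (b := 3) (c := 0) (d := 1) (by decide)
    calc _ ≤ 2 * K * ((K : ℝ) * (n : ℝ) ^ 3 + K * (n : ℝ) ^ 3) := by gcongr
      _ = _ := by ring
  rw [Finset.sum_sub_distrib, ← Finset.mul_sum, sum_delta_vertexClass F hn] at hsum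
  refine le_of_mul_le_mul_left ?_ hn0
  rw [← abs_of_pos hn0, ← abs_mul, abs_of_pos hn0]
  calc _ = _ := by congr 1; ring
    _ ≤ _ := hsum
    _ = _ := by ring

end

section

/-! ### The differential equation -/

section GlobalExistence

variable {E : Type*} [NormedAddCommGroup E] [NormedSpace ℝ E]

lemma hasDerivWithinAt_Ici_of_Icc {f : ℝ → E} {f' : E} {a b t : ℝ} (ht : t ∈ Ico a b)
    (h : HasDerivWithinAt f f' (Icc a b) t) : HasDerivWithinAt f f' (Ici t) t :=
  h.mono_of_mem_nhdsWithin (Icc_mem_nhdsGE_of_mem ht)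

/-- A bounded Lipschitz vector field has global forward solutions. -/
lemma exists_forall_hasDerivWithinAt_of_lipschitz [CompleteSpace E] {g : E → E} {L B : ℝ≥0}
    (hL : LipschitzWith L g) (hB : ∀ x, ‖g x‖ ≤ B) (x₀ : E) :
    ∃ α : ℝ → E, α 0 = x₀ ∧ ∀ t, 0 ≤ t → HasDerivWithinAt α (g (α t)) (Ici 0) t := by
  have hloc : ∀ N : ℕ, ∃ α : ℝ → E, α 0 = x₀ ∧
      ∀ t ∈ Icc (0 : ℝ) (N + 1), HasDerivWithinAt α (g (α t)) (Icc 0 (N + 1)) t := by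
    intro N
    have hN : (0 : ℝ) ≤ N + 1 := by positivity
    have hPL : IsPicardLindelof (fun _ => g) (⟨0, left_mem_Icc.2 hN⟩ : Icc (0 : ℝ) (N + 1)) x₀
        (B * (N + 1)) 0 B L :=
      IsPicardLindelof.of_time_independent (fun x _ => hB x) hL.lipschitzOnWith (by simp [hN])
    exact hPL.exists_eq_forall_mem_Icc_hasDerivWithinAt₀
  choose α h0 hα using hloc
  have hcompat : ∀ M N : ℕ, M ≤ N → EqOn (α M) (α N) (Icc 0 (M + 1)) := by
    intro M N hMN
    have hMN' : (M : ℝ) + 1 ≤ N + 1 := by gcongr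
    have hsub : Icc (0 : ℝ) (M + 1) ⊆ Icc 0 (N + 1) := Icc_subset_Icc_right hMN'
    refine ODE_solution_unique_of_mem_Icc_right (v := fun _ => g) (s := fun _ => univ) (K := L)
      (fun _ _ => hL.lipschitzOnWith) (fun t ht => (hα M t ht).continuousWithinAt)
      (fun t ht => hasDerivWithinAt_Ici_of_Icc ht (hα M t (Ico_subset_Icc_self ht)))
      (fun _ _ => mem_univ _)
      (fun t ht => ((hα N t (hsub ht)).continuousWithinAt).mono hsub)
      (fun t ht => hasDerivWithinAt_Ici_of_Icc (b := N + 1) ⟨ht.1, ht.2.trans_le hMN'⟩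
        (hα N t (hsub (Ico_subset_Icc_self ht)))) (fun _ _ => mem_univ _) (by rw [h0, h0])
  have heq : ∀ (N : ℕ), ∀ t ∈ Ico (0 : ℝ) (N + 1), α ⌊t⌋₊ t = α N t := by
    intro N t ht
    have hfl : ⌊t⌋₊ ≤ N := by
      have : ⌊t⌋₊ < N + 1 := (Nat.floor_lt ht.1).2 (by exact_mod_cast ht.2)
      omega
    exact hcompat _ _ hfl ⟨ht.1, (Nat.lt_floor_add_one t).le⟩
  refine ⟨fun t => α ⌊t⌋₊ t, by simp [h0], fun t ht => ?_⟩
  have htN : t ∈ Ico (0 : ℝ) (⌊t⌋₊ + 1) := ⟨ht, Nat.lt_floor_add_one t⟩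
  have hmem : Ico (0 : ℝ) (⌊t⌋₊ + 1) ∈ nhdsWithin t (Ici 0) := by
    rw [← Ici_inter_Iio]
    exact inter_mem_nhdsWithin _ (Iio_mem_nhds htN.2)
  have h1 := ((hα ⌊t⌋₊ t (Ico_subset_Icc_self htN)).mono Ico_subset_Icc_self).congr
    (f₁ := fun t => α ⌊t⌋₊ t) (fun s hs => heq _ s hs) (heq _ t htN)
  exact h1.mono_of_mem_nhdsWithin hmem

end GlobalExistence

/-- A function cannot become negative if it is nondecreasing whenever it is negative. -/
lemma nonneg_of_deriv_nonneg_of_neg {y y' : ℝ → ℝ} (h0 : 0 ≤ y 0)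
    (hy : ∀ t, 0 ≤ t → HasDerivWithinAt y (y' t) (Ici 0) t)
    (hneg : ∀ t, 0 ≤ t → y t < 0 → 0 ≤ y' t) {t : ℝ} (ht : 0 ≤ t) : 0 ≤ y t := by
  have key : ∀ ε : ℝ, 0 < ε → -y t ≤ ε * (1 + t) := by
    intro ε hε
    refine image_le_of_deriv_right_lt_deriv_boundary (f := fun s => -y s) (f' := fun s => -y' s)
      (a := 0) (b := t) (B := fun s => ε * (1 + s)) (B' := fun _ => ε) ?_ ?_ ?_ ?_ ?_
      (right_mem_Icc.2 ht)
    · exact fun s hs => ((hy s hs.1).continuousWithinAt.mono Icc_subset_Ici_self).neg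
    · exact fun s hs => ((hy s hs.1).mono (Ici_subset_Ici.2 hs.1)).neg
    · simp only [add_zero, mul_one]; linarith
    · intro s
      simpa using ((hasDerivAt_id s).const_add 1).const_mul ε
    · intro s hs hse
      have h1 : 0 < ε * (1 + s) := mul_pos hε (by linarith [hs.1])
      have := hneg s hs.1 (by linarith)
      linarith
  by_contra hlt
  push Not at hlt
  have h1 : 0 < 1 + t := by linarith
  have h2 := key (-y t / (2 * (1 + t))) (by apply div_pos <;> linarith)
  have h3 : -y t / (2 * (1 + t)) * (1 + t) = -y t / 2 := by field_simp
  linarith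

variable {K : ℕ} (F : Finset (Fin 4 → SizeClass K))

/-- The coordinatewise projection to the unit cube. -/
def clampCube (x : SizeClass K → ℝ) (i : SizeClass K) : ℝ := max 0 (min 1 (x i))

lemma clampCube_mem (x : SizeClass K → ℝ) : clampCube x ∈ Icc (0 : SizeClass K → ℝ) 1 :=
  ⟨fun _ => le_max_left _ _, fun _ => max_le zero_le_one (min_le_left _ _)⟩

lemma clampCube_of_mem {x : SizeClass K → ℝ} (hx : x ∈ Icc (0 : SizeClass K → ℝ) 1) :
    clampCube x = x := by
  funext i
  have h0 : 0 ≤ x i := hx.1 i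
  have h1 : x i ≤ 1 := hx.2 i
  rw [clampCube, min_eq_right h1, max_eq_right h0]

lemma lipschitzWith_clampCube : LipschitzWith 1 (clampCube (K := K)) := by
  refine LipschitzWith.of_dist_le_mul fun x y => ?_
  rw [NNReal.coe_one, one_mul]
  refine (dist_pi_le_iff dist_nonneg).2 fun i => le_trans ?_ (dist_le_pi_dist x y i)
  have h : LipschitzWith 1 fun a : ℝ => max 0 (min 1 a) :=
    (LipschitzWith.id.const_min 1).const_max 0
  simpa [clampCube] using h.dist_le_mul (x i) (y i)

/-- The truncated field `x ↦ drift F (clampCube x)` has a global solution; this stays in the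
simplex, where the two fields agree. -/
lemma exists_isODESolution :
    ∃ x, IsODESolution F x ∧ ∀ t, 0 ≤ t → x t ∈ Icc (0 : SizeClass K → ℝ) 1 := by
  obtain ⟨L, hL⟩ := exists_lipschitzOnWith_drift F (isCompact_Icc (a := 0) (b := 1))
  obtain ⟨B, hB⟩ := exists_norm_drift_le F (isCompact_Icc (a := 0) (b := 1))
  have hg : LipschitzWith L fun x => drift F (clampCube x) := by
    have := hL.comp (lipschitzWith_clampCube (K := K)).lipschitzOnWith
      (s := univ) (fun x _ => clampCube_mem x)
    rwa [mul_one, lipschitzOnWith_univ] at this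
  obtain ⟨x, hx0, hx⟩ := exists_forall_hasDerivWithinAt_of_lipschitz hg
    (fun x => hB _ (clampCube_mem x)) (fun i => if i = sizeClass K 1 then (1 : ℝ) else 0)
  have hxi : ∀ t, 0 ≤ t → ∀ i,
      HasDerivWithinAt (fun s => x s i) (drift F (clampCube (x t)) i) (Ici 0) t :=
    fun t ht => hasDerivWithinAt_pi.1 (hx t ht)
  have hnonneg : ∀ i, ∀ t, 0 ≤ t → 0 ≤ x t i := by
    intro i t ht
    refine nonneg_of_deriv_nonneg_of_neg (y := fun s => x s i) ?_ (fun t ht => hxi t ht i) ?_ ht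
    · rw [hx0]; dsimp only; split_ifs <;> norm_num
    · intro s hs hneg
      refine drift_nonneg F (fun j => (clampCube_mem (x s)).1 j) ?_
      exact max_eq_left ((min_le_right _ _).trans hneg.le)
  have hsum : ∀ t, 0 ≤ t → ∑ i, x t i = 1 := by
    intro t ht
    have hd : ∀ s, 0 ≤ s → HasDerivWithinAt (fun s => ∑ i, x s i) 0 (Ici 0) s := by
      intro s hs
      have := HasDerivWithinAt.fun_sum (u := Finset.univ) fun i _ => hxi s hs i
      rwa [sum_drift] at this
    rw [constant_of_has_deriv_right_zero (f := fun s => ∑ i, x s i) (a := 0) (b := t)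
      (fun s hs => (hd s hs.1).continuousWithinAt.mono Icc_subset_Ici_self)
      (fun s hs => (hd s hs.1).mono (Ici_subset_Ici.2 hs.1)) t (right_mem_Icc.2 ht), hx0]
    simp
  have hbox : ∀ t, 0 ≤ t → x t ∈ Icc (0 : SizeClass K → ℝ) 1 := fun t ht =>
    ⟨fun i => hnonneg i t ht, fun i => by
      rw [Pi.one_apply, ← hsum t ht]
      exact Finset.single_le_sum (fun j _ => hnonneg j t ht) (Finset.mem_univ i)⟩
  refine ⟨x, ⟨fun i => by rw [hx0], fun t ht i => ?_⟩, hbox⟩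
  have := hxi t ht i
  rwa [clampCube_of_mem (hbox t ht)] at this

variable {F}

lemma IsODESolution.hasDerivWithinAt {x : ℝ → SizeClass K → ℝ} (hx : IsODESolution F x) {t : ℝ}
    (ht : 0 ≤ t) : HasDerivWithinAt x (drift F (x t)) (Ici 0) t :=
  hasDerivWithinAt_pi.2 (hx.deriv t ht)

lemma IsODESolution.hasDerivWithinAt_Ici {x : ℝ → SizeClass K → ℝ} (hx : IsODESolution F x)
    {t : ℝ} (ht : 0 ≤ t) : HasDerivWithinAt x (drift F (x t)) (Ici t) t :=
  (hx.hasDerivWithinAt ht).mono (Ici_subset_Ici.2 ht)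

lemma IsODESolution.continuousOn {x : ℝ → SizeClass K → ℝ} (hx : IsODESolution F x) {a b : ℝ}
    (ha : 0 ≤ a) : ContinuousOn x (Icc a b) := fun _ ht =>
  (hx.hasDerivWithinAt (ha.trans ht.1)).continuousWithinAt.mono
    (Icc_subset_Ici_self.trans (Ici_subset_Ici.2 ha))

lemma IsODESolution.unique {x y : ℝ → SizeClass K → ℝ} (hx : IsODESolution F x)
    (hy : IsODESolution F y) {t : ℝ} (ht : 0 ≤ t) : y t = x t := by
  have hxc := hx.continuousOn (a := 0) (b := t) le_rfl
  have hyc := hy.continuousOn (a := 0) (b := t) le_rfl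
  obtain ⟨L, hL⟩ := exists_lipschitzOnWith_drift F
    ((isCompact_Icc.image_of_continuousOn hxc).union (isCompact_Icc.image_of_continuousOn hyc))
  refine ODE_solution_unique_of_mem_Icc_right (v := fun _ => drift F) (fun _ _ => hL) hyc
    (fun s hs => hy.hasDerivWithinAt_Ici hs.1)
    (fun s hs => Or.inr (mem_image_of_mem _ (Ico_subset_Icc_self hs))) hxc
    (fun s hs => hx.hasDerivWithinAt_Ici hs.1)
    (fun s hs => Or.inl (mem_image_of_mem _ (Ico_subset_Icc_self hs))) ?_ (right_mem_Icc.2 ht)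
  funext i
  rw [hx.init, hy.init]

section Bounds

variable {x : ℝ → SizeClass K → ℝ} {L B : ℝ≥0}

lemma IsODESolution.norm_sub_le (hx : IsODESolution F x)
    (hB : ∀ t, 0 ≤ t → ‖drift F (x t)‖ ≤ B) {s t : ℝ} (hs : 0 ≤ s) (hst : s ≤ t) :
    ‖x t - x s‖ ≤ B * (t - s) :=
  norm_image_sub_le_of_norm_deriv_right_le_segment (hx.continuousOn hs)
    (fun _ hu => hx.hasDerivWithinAt_Ici (hs.trans hu.1)) (fun u hu => hB u (hs.trans hu.1)) t
    (right_mem_Icc.2 hst)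

lemma IsODESolution.norm_euler_step_le (hx : IsODESolution F x)
    (hB : ∀ t, 0 ≤ t → ‖drift F (x t)‖ ≤ B)
    (hbox : ∀ t, 0 ≤ t → x t ∈ Icc (0 : SizeClass K → ℝ) 1)
    (hL : LipschitzOnWith L (drift F) (Icc 0 1)) {t h : ℝ} (ht : 0 ≤ t) (hh : 0 ≤ h) :
    ‖x (t + h) - x t - h • drift F (x t)‖ ≤ L * B * h ^ 2 := by
  have hc : ContinuousOn (fun s => x s - (s - t) • drift F (x t)) (Icc t (t + h)) :=
    (hx.continuousOn ht).sub (by fun_prop)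
  have hd : ∀ s ∈ Ico t (t + h), HasDerivWithinAt (fun s => x s - (s - t) • drift F (x t))
      (drift F (x s) - drift F (x t)) (Ici s) s := by
    intro s hs
    have h1 : HasDerivAt (fun s : ℝ => (s - t) • drift F (x t)) (drift F (x t)) s := by
      simpa using ((hasDerivAt_id s).sub_const t).smul_const (drift F (x t))
    exact (hx.hasDerivWithinAt_Ici (ht.trans hs.1)).sub h1.hasDerivWithinAt
  have hb : ∀ s ∈ Ico t (t + h), ‖drift F (x s) - drift F (x t)‖ ≤ L * (B * h) := by
    intro s hs
    refine (hL.norm_sub_le (hbox s (ht.trans hs.1)) (hbox t ht)).trans ?_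
    gcongr
    refine (hx.norm_sub_le hB ht hs.1).trans ?_
    gcongr
    linarith [hs.2]
  have := norm_image_sub_le_of_norm_deriv_right_le_segment hc hd hb (t + h)
    (right_mem_Icc.2 (by linarith))
  simp only [sub_self, zero_smul, sub_zero, add_sub_cancel_left] at this
  calc _ = ‖x (t + h) - h • drift F (x t) - x t‖ := by congr 1; abel
    _ ≤ _ := this
    _ = _ := by ring

end Bounds

/-- Comparison of a perturbed Euler scheme `X` with an Euler scheme `y`: `ε` bounds the accumulated
noise, `η` and `η'` bound the errors of single steps. -/
lemma norm_sub_le_of_perturbed_euler {E : Type*} [NormedAddCommGroup E] [NormedSpace ℝ E]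
    {g : E → E} {X y b : ℕ → E} {h L ε η η' : ℝ} {m : ℕ} (hh : 0 ≤ h) (hL : 0 ≤ L)
    (hε : 0 ≤ ε) (hη : 0 ≤ η) (hη' : 0 ≤ η') (h0 : X 0 = y 0)
    (hX : ∀ k ≤ m, ‖X k - X 0 - ∑ j ∈ Finset.range k, b j‖ ≤ ε)
    (hb : ∀ k, ‖b k - h • g (X k)‖ ≤ η)
    (hy : ∀ k, ‖y (k + 1) - y k - h • g (y k)‖ ≤ η')
    (hg : ∀ k, ‖g (X k) - g (y k)‖ ≤ L * ‖X k - y k‖) {k : ℕ} (hk : k ≤ m) :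
    ‖X k - y k‖ ≤ (ε + m * (η + η')) * Real.exp (L * (m * h)) := by
  set w : ℕ → ℝ := fun k =>
    ε + ∑ j ∈ Finset.range k, (η + η' + h * L * ‖X j - y j‖) with hw
  have hstep : ∀ j, ‖b j - (y (j + 1) - y j)‖ ≤ η + η' + h * L * ‖X j - y j‖ := by
    intro j
    have e : b j - (y (j + 1) - y j) = (b j - h • g (X j)) +
        h • (g (X j) - g (y j)) - (y (j + 1) - y j - h • g (y j)) := by
      rw [smul_sub]; abel
    rw [e]
    refine (_root_.norm_sub_le _ _).trans ((add_le_add (norm_add_le _ _) le_rfl).trans ?_)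
    rw [norm_smul, Real.norm_of_nonneg hh]
    have := mul_le_mul_of_nonneg_left (hg j) hh
    have := hb j; have := hy j
    linarith
  have hle : ∀ k ≤ m, ‖X k - y k‖ ≤ w k := by
    intro k hk
    have e : X k - y k = (X k - X 0 - ∑ j ∈ Finset.range k, b j) +
        ∑ j ∈ Finset.range k, (b j - (y (j + 1) - y j)) := by
      rw [Finset.sum_sub_distrib, Finset.sum_range_sub, h0]; abel
    rw [e]
    exact (norm_add_le _ _).trans (add_le_add (hX k hk)
      ((norm_sum_le _ _).trans (Finset.sum_le_sum fun j _ => hstep j)))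
  have hw0 : ∀ k, 0 ≤ w k := fun k =>
    add_nonneg hε (Finset.sum_nonneg fun j _ => by positivity)
  have hgr : ∀ k ≤ m, w k ≤ (ε + k * (η + η')) * Real.exp (k * (h * L)) := by
    intro k
    induction k with
    | zero => intro _; simp [hw]
    | succ k ih =>
      intro hk
      have hws : w (k + 1) = w k + (η + η' + h * L * ‖X k - y k‖) := by
        simp only [hw, Finset.sum_range_succ]; ring
      have h1 : w (k + 1) ≤ (1 + h * L) * w k + (η + η') := by
        have := mul_le_mul_of_nonneg_left (hle k (by omega)) (mul_nonneg hh hL)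
        rw [hws]; linarith
      have h2 := ih (by omega)
      have h3 : 1 + h * L ≤ Real.exp (h * L) := by
        linarith [Real.add_one_le_exp (h * L)]
      have h4 : (1 : ℝ) ≤ Real.exp ((k + 1 : ℕ) * (h * L)) := Real.one_le_exp (by positivity)
      have h5 : Real.exp ((k + 1 : ℕ) * (h * L)) =
          Real.exp (h * L) * Real.exp (k * (h * L)) := by
        rw [← Real.exp_add]; push_cast; ring_nf
      calc w (k + 1) ≤ (1 + h * L) * w k + (η + η') := h1
        _ ≤ Real.exp (h * L) * ((ε + k * (η + η')) * Real.exp (k * (h * L))) +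
            (η + η') * Real.exp ((k + 1 : ℕ) * (h * L)) := by
          refine add_le_add (mul_le_mul h3 h2 (hw0 k) (Real.exp_pos _).le) ?_
          exact le_mul_of_one_le_right (by positivity) h4
        _ = _ := by rw [h5]; push_cast; ring
  refine (hle k hk).trans ((hgr k hk).trans ?_)
  have hkm : (k : ℝ) ≤ m := by exact_mod_cast hk
  refine mul_le_mul (by gcongr) (Real.exp_le_exp.2 ?_) (Real.exp_pos _).le (by positivity)
  calc (k : ℝ) * (h * L) ≤ m * (h * L) := by gcongr
    _ = _ := by ring

end

/-! ### A maximal inequality for chains driven by independent inputs -/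

section Maximal

variable {S E : Type*}

/-- The orbit of `s` under `f` when the inputs are `e 0, e 1, …`. -/
def orbit (f : S → E → S) (s : S) (e : ℕ → E) : ℕ → S
  | 0 => s
  | k + 1 => f (orbit f s e k) (e k)

lemma orbit_succ' (f : S → E → S) (s : S) (e : ℕ → E) (k : ℕ) :
    orbit f s e (k + 1) = orbit f (f s (e 0)) (fun j => e (j + 1)) k := by
  induction k with
  | zero => rfl
  | succ k ih => rw [orbit, ih]; rfl

/-- The orbit of `s` under the inputs `e` visits `P` within `m` steps; a recursion on the first
input, so that `m` inputs suffice. -/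
def Visits (f : S → E → S) (P : S → Prop) : (m : ℕ) → S → (Fin m → E) → Prop
  | 0, s, _ => P s
  | m + 1, s, e => P s ∨ Visits f P m (f s (e 0)) (Fin.tail e)

lemma visits_of_orbit {f : S → E → S} {P : S → Prop} {m k : ℕ} (hk : k ≤ m) {s : S} {e : ℕ → E}
    (h : P (orbit f s e k)) : Visits f P m s fun i => e i := by
  induction m generalizing k s e with
  | zero =>
    obtain rfl : k = 0 := by omega
    exact h
  | succ m ih =>
    cases k with
    | zero => exact Or.inl h
    | succ k =>
      rw [orbit_succ'] at h
      exact Or.inr (ih (by omega) h)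

open Classical in
/-- Doob's maximal inequality for a nonnegative supermartingale `Z`, by first-step analysis. -/
lemma sum_visits_le [Fintype E] {q : E → ℝ} (hq : ∀ e, 0 ≤ q e) (hq1 : ∑ e, q e = 1)
    {f : S → E → S} {Z : S → ℝ} (hZ0 : ∀ s, 0 ≤ Z s) (hZ : ∀ s, ∑ e, q e * Z (f s e) ≤ Z s)
    {a : ℝ} (ha : 0 < a) (m : ℕ) (s : S) :
    ∑ e : Fin m → E, (if Visits f (fun s => a ≤ Z s) m s e then ∏ i, q (e i) else 0) ≤
      Z s / a := by
  have htot : ∀ m : ℕ, ∑ e : Fin m → E, ∏ i, q (e i) = 1 := by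
    intro m
    have := Finset.prod_univ_sum (fun _ : Fin m => (Finset.univ : Finset E)) (fun _ e => q e)
    rw [Fintype.piFinset_univ] at this
    rw [← this]
    simp [hq1]
  have hbig : ∀ (m : ℕ) (s : S), a ≤ Z s →
      ∑ e : Fin m → E, (if Visits f (fun s => a ≤ Z s) m s e then ∏ i, q (e i) else 0) ≤
        Z s / a := by
    intro m s h
    refine le_trans (Finset.sum_le_sum fun e _ => ?_)
      ((htot m).le.trans ((one_le_div ha).2 h))
    split_ifs
    · exact le_rfl
    · exact Finset.prod_nonneg fun i _ => hq _
  induction m generalizing s with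
  | zero =>
    by_cases h : a ≤ Z s
    · exact hbig 0 s h
    · refine (Finset.sum_nonpos fun e _ => ?_).trans (div_nonneg (hZ0 s) ha.le)
      exact (if_neg h).le
  | succ m ih =>
    by_cases h : a ≤ Z s
    · exact hbig _ s h
    · rw [← (Fin.consEquiv fun _ : Fin (m + 1) => E).sum_comp, Fintype.sum_prod_type]
      calc _ = ∑ x, q x * ∑ e : Fin m → E,
            (if Visits f (fun s => a ≤ Z s) m (f s x) e then ∏ i, q (e i) else 0) := by
            refine Finset.sum_congr rfl fun x _ => ?_
            rw [Finset.mul_sum]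
            refine Finset.sum_congr rfl fun e _ => ?_
            have ht : Fin.tail ((Fin.consEquiv fun _ : Fin (m + 1) => E) (x, e)) = e :=
              Fin.tail_cons (α := fun _ => E) x e
            simp only [Visits, h, false_or, ht, Fin.consEquiv_apply, Fin.cons_zero,
              Fin.prod_univ_succ, Fin.cons_succ, mul_ite, mul_zero]
        _ ≤ ∑ x, q x * (Z (f s x) / a) :=
            Finset.sum_le_sum fun x _ => mul_le_mul_of_nonneg_left (ih _) (hq x)
        _ = (∑ x, q x * Z (f s x)) / a := by
            rw [Finset.sum_div]
            exact Finset.sum_congr rfl fun x _ => by ring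
        _ ≤ Z s / a := by gcongr; exact hZ s

end Maximal

lemma exp_le_one_add_add_sq {x : ℝ} (hx : |x| ≤ 1) : Real.exp x ≤ 1 + x + x ^ 2 := by
  have := Real.abs_exp_sub_one_sub_id_le hx
  have := (abs_le.1 this).2
  linarith

/-- The exponential moment of a centred increment that is at most `c` in modulus and nonzero with
probability at most `p`. -/
lemma sum_mul_exp_sub_mean_le {E : Type*} [Fintype E] {q D : E → ℝ} (hq : ∀ e, 0 ≤ q e)
    (hq1 : ∑ e, q e = 1) {c p l : ℝ} (hD : ∀ e, |D e| ≤ c)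
    (hp : ∑ e, (if D e = 0 then 0 else q e) ≤ p) (hl : |l| * c ≤ 1) :
    ∑ e, q e * Real.exp (l * (D e - ∑ e, q e * D e) - l ^ 2 * c ^ 2 * p) ≤ 1 := by
  set M := ∑ e, q e * D e with hM
  have h2 : ∀ e, q e * Real.exp (l * D e) ≤
      q e + l * (q e * D e) + l ^ 2 * c ^ 2 * (if D e = 0 then 0 else q e) := by
    intro e
    split_ifs with h0
    · simp [h0]
    · have h1 : |l * D e| ≤ |l| * c := by
        rw [abs_mul]; exact mul_le_mul_of_nonneg_left (hD e) (abs_nonneg _)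
      have h3 := exp_le_one_add_add_sq (h1.trans hl)
      have h4 : (l * D e) ^ 2 ≤ l ^ 2 * c ^ 2 := by
        rw [mul_pow]
        refine mul_le_mul_of_nonneg_left ?_ (sq_nonneg _)
        rw [← sq_abs (D e)]
        exact pow_le_pow_left₀ (abs_nonneg _) (hD e) 2
      calc q e * Real.exp (l * D e) ≤ q e * (1 + l * D e + l ^ 2 * c ^ 2) :=
            mul_le_mul_of_nonneg_left (by linarith) (hq e)
        _ = _ := by ring
  have h3 : ∑ e, q e * Real.exp (l * D e) ≤ Real.exp (l * M + l ^ 2 * c ^ 2 * p) := by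
    refine (Finset.sum_le_sum fun e _ => h2 e).trans ?_
    rw [Finset.sum_add_distrib, Finset.sum_add_distrib, ← Finset.mul_sum, ← Finset.mul_sum, hq1,
      ← hM]
    have h5 := mul_le_mul_of_nonneg_left hp (by positivity : 0 ≤ l ^ 2 * c ^ 2)
    have h6 := Real.add_one_le_exp (l * M + l ^ 2 * c ^ 2 * p)
    linarith
  have h4 : ∀ e, q e * Real.exp (l * (D e - M) - l ^ 2 * c ^ 2 * p) =
      q e * Real.exp (l * D e) * Real.exp (-(l * M + l ^ 2 * c ^ 2 * p)) := by
    intro e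
    rw [mul_assoc (q e), ← Real.exp_add]
    ring_nf
  rw [Finset.sum_congr rfl fun e _ => h4 e, ← Finset.sum_mul]
  refine (mul_le_mul_of_nonneg_right h3 (Real.exp_pos _).le).trans ?_
  rw [← Real.exp_add]
  simp

open Classical in
/-- A Freedman-type maximal inequality: along a chain driven by independent inputs of law `q`, the
compensated sum of the increments of `φ` rarely exceeds `ε` within `m` steps. -/
lemma sum_exists_compensated_gt_le {S E : Type*} [Fintype E] {q : E → ℝ}
    (hq : ∀ e, 0 ≤ q e) (hq1 : ∑ e, q e = 1) (f : S → E → S) (φ : S → ℝ) {c p l ε : ℝ}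
    (hD : ∀ s e, |φ (f s e) - φ s| ≤ c)
    (hp : ∀ s, ∑ e, (if φ (f s e) - φ s = 0 then 0 else q e) ≤ p) (hp0 : 0 ≤ p)
    (hl0 : 0 < l) (hl : l * c ≤ 1) (m : ℕ) (s : S) :
    ∑ e : Fin m → E, (if ∃ e' : ℕ → E, (∀ i : Fin m, e' i = e i) ∧ ∃ k ≤ m,
      ε ≤ φ (orbit f s e' k) - φ s -
        ∑ j ∈ Finset.range k, ∑ x, q x * (φ (f (orbit f s e' j) x) - φ (orbit f s e' j))
      then ∏ i, q (e i) else 0) ≤ Real.exp (-(l * ε) + m * (l ^ 2 * c ^ 2 * p)) := by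
  set b : S → ℝ := fun s => ∑ x, q x * (φ (f s x) - φ s) with hb
  set r : ℝ := l ^ 2 * c ^ 2 * p with hr
  have hr0 : 0 ≤ r := by positivity
  -- the second component of the enlarged state is the logarithm of the exponential supermartingale
  set f' : S × ℝ → E → S × ℝ := fun s e =>
    (f s.1 e, s.2 + (l * (φ (f s.1 e) - φ s.1 - b s.1) - r)) with hf'
  have hZ : ∀ s : S × ℝ, ∑ e, q e * Real.exp (f' s e).2 ≤ Real.exp s.2 := by
    intro s
    have h1 := sum_mul_exp_sub_mean_le (D := fun e => φ (f s.1 e) - φ s.1) hq hq1 (hD s.1)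
      (hp s.1) (l := l) (by rwa [abs_of_pos hl0])
    calc _ = Real.exp s.2 *
          ∑ e, q e * Real.exp (l * (φ (f s.1 e) - φ s.1 - b s.1) - r) := by
          rw [Finset.mul_sum]
          refine Finset.sum_congr rfl fun e _ => ?_
          simp only [hf', Real.exp_add]
          ring
      _ ≤ Real.exp s.2 * 1 := mul_le_mul_of_nonneg_left h1 (Real.exp_pos _).le
      _ = _ := mul_one _
  have horb : ∀ (e' : ℕ → E) (k : ℕ), orbit f' (s, 0) e' k = (orbit f s e' k,
      l * (φ (orbit f s e' k) - φ s - ∑ j ∈ Finset.range k, b (orbit f s e' j)) - k * r) := by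
    intro e' k
    induction k with
    | zero => simp [orbit]
    | succ k ih =>
      rw [orbit, ih, hf', Finset.sum_range_succ]
      simp only [orbit, Prod.mk.injEq, true_and]
      push_cast
      ring
  have hmain := sum_visits_le hq hq1 (f := f') (Z := fun s => Real.exp s.2)
    (fun s => (Real.exp_pos _).le) hZ (Real.exp_pos (l * ε - m * r)) m (s, 0)
  refine le_trans (Finset.sum_le_sum fun e _ => ?_) (hmain.trans_eq ?_)
  · have hpn : 0 ≤ ∏ i, q (e i) := Finset.prod_nonneg fun i _ => hq _
    split_ifs with h1 h2 h2
    · exact le_rfl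
    · obtain ⟨e', he', k, hk, hge⟩ := h1
      refine (h2 ?_).elim
      obtain rfl : (fun i : Fin m => e' i) = e := funext he'
      refine visits_of_orbit hk ?_
      rw [horb]
      refine Real.exp_le_exp.2 ?_
      have h3 : (k : ℝ) * r ≤ m * r := by gcongr
      have h4 := mul_le_mul_of_nonneg_left hge hl0.le
      simp only [hb]
      linarith
    · exact hpn
    · exact le_rfl
  · simp only [Real.exp_zero]
    rw [one_div, ← Real.exp_neg]
    ring_nf

/-! ### Poisson increments over a fine grid -/

section Group

variable {Ω ι κ : Type*} [MeasurableSpace Ω] {μ : Measure Ω}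

lemma measureReal_forall_eq_prod [Fintype ι] {β : Type*} [MeasurableSpace β]
    [DiscreteMeasurableSpace β] {Y : ι → Ω → β} (h : iIndepFun Y μ) (S : ι → Set β) :
    μ.real {ω | ∀ i, Y i ω ∈ S i} = ∏ i, μ.real {ω | Y i ω ∈ S i} := by
  have h1 := h.measure_inter_preimage_eq_mul Finset.univ (sets := S) fun _ _ => .of_discrete
  have h2 : {ω | ∀ i, Y i ω ∈ S i} = ⋂ i ∈ Finset.univ, Y i ⁻¹' S i := by ext; simp
  rw [measureReal_def, h2, h1, ENNReal.toReal_prod]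
  rfl

/-- Independent variables indexed by pairs stay independent when grouped into vectors. -/
lemma iIndepFun_group [Fintype ι] [Fintype κ] {Y : ι → κ → Ω → ℕ}
    (hY : ∀ i k, Measurable (Y i k)) (h : iIndepFun (fun p : ι × κ => Y p.1 p.2) μ) :
    iIndepFun (fun k ω i => Y i k ω) μ := by
  have := h.isProbabilityMeasure
  have hm : ∀ k, Measurable fun ω i => Y i k ω := fun k => measurable_pi_lambda _ fun i => hY i k
  have hr : ∀ k (c : ι → ℕ),
      μ ((fun ω i => Y i k ω) ⁻¹' {c}) = ∏ i, μ (Y i k ⁻¹' {c i}) := by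
    intro k c
    have hk : iIndepFun (fun i => Y i k) μ :=
      h.precomp (g := fun i => (i, k)) fun i j hij => (Prod.mk.inj hij).1
    rw [← hk.measure_inter_preimage_eq_mul Finset.univ (sets := fun i => {c i})
      fun _ _ => .of_discrete]
    congr 1
    ext ω; simp [funext_iff]
  rw [iIndepFun_iff_map_fun_eq_pi_map fun k => (hm k).aemeasurable]
  refine Measure.ext_of_singleton fun c => ?_
  rw [Measure.map_apply (measurable_pi_lambda _ hm) (measurableSet_singleton c),
    Measure.pi_singleton]
  simp_rw [Measure.map_apply (hm _) (measurableSet_singleton _), hr]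
  rw [← Fintype.prod_prod_type_right' (fun i k => μ (Y i k ⁻¹' {c k i})),
    ← h.measure_inter_preimage_eq_mul Finset.univ (sets := fun p => {c p.2 p.1})
      fun _ _ => .of_discrete]
  congr 1
  ext ω
  simp only [mem_preimage, mem_singleton_iff, funext_iff, mem_iInter, Finset.mem_univ,
    true_imp_iff, Prod.forall]
  exact forall_comm

end Group

section UniquePoint

variable {V : Type*} [DecidableEq V]

open Classical in
/-- `some v` if the counts `c` consist of one single point, belonging to `v`; otherwise `none`. -/
noncomputable def uniquePoint (c : V → ℕ) : Option V :=
  if h : ∃ v, c = Pi.single v 1 then some h.choose else none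

lemma uniquePoint_eq_some_iff {c : V → ℕ} {v : V} :
    uniquePoint c = some v ↔ c = Pi.single v 1 := by
  unfold uniquePoint
  constructor
  · intro h
    split_ifs at h with hex
    obtain rfl := Option.some.inj h
    exact hex.choose_spec
  · rintro rfl
    have hex : ∃ w, (Pi.single v 1 : V → ℕ) = Pi.single w 1 := ⟨v, rfl⟩
    rw [dif_pos hex]
    congr 1
    by_contra hne
    have := congrFun hex.choose_spec v
    rw [Pi.single_eq_same, Pi.single_eq_of_ne (Ne.symm hne)] at this
    exact one_ne_zero this

end UniquePoint

section PointWeight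

/-- The law of `uniquePoint c` if the `c v` are independent Poisson variables of mean `x`. -/
noncomputable def pointWeight (V : Type*) [Fintype V] (x : ℝ) : Option V → ℝ
  | some _ => x * Real.exp (-(Fintype.card V * x))
  | none => 1 - Fintype.card V * (x * Real.exp (-(Fintype.card V * x)))

variable {V : Type*} [Fintype V]

lemma pointWeight_nonneg {x : ℝ} (hx : 0 ≤ x) (o : Option V) : 0 ≤ pointWeight V x o := by
  cases o with
  | some v => exact mul_nonneg hx (Real.exp_pos _).le
  | none =>
    set y : ℝ := Fintype.card V * x
    have h1 := Real.add_one_le_exp y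
    have h2 : y * Real.exp (-y) ≤ Real.exp y * Real.exp (-y) :=
      mul_le_mul_of_nonneg_right (by linarith) (Real.exp_pos _).le
    rw [← Real.exp_add, add_neg_cancel, Real.exp_zero] at h2
    simp only [pointWeight]
    rw [← mul_assoc]
    linarith

lemma sum_pointWeight (x : ℝ) : ∑ o, pointWeight V x o = 1 := by
  rw [Fintype.sum_option]
  simp [pointWeight]

end PointWeight

section Increments

variable {Ω V : Type*} [MeasurableSpace Ω] {μ : Measure Ω} {N : V → ℝ≥0 → Ω → ℕ} {r : ℝ≥0}

/-- The numbers of points of the processes in the `k`-th interval of the grid of mesh `h`. -/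
def gridIncrement (N : V → ℝ≥0 → ℕ) (h : ℝ≥0) (k : ℕ) (v : V) : ℕ :=
  N v ((k + 1 : ℕ) * h) - N v (k * h)

lemma measurable_gridIncrement (hN : ∀ v, IsPoissonProcess (N v) r μ) (h : ℝ≥0) (k : ℕ) (v : V) :
    Measurable fun ω => gridIncrement (fun v t => N v t ω) h k v :=
  ((hN v).measurable _).sub ((hN v).measurable _)

lemma measurable_gridIncrement_pi (hN : ∀ v, IsPoissonProcess (N v) r μ) (h : ℝ≥0) (k : ℕ) :
    Measurable fun ω => gridIncrement (fun v t => N v t ω) h k :=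
  measurable_pi_lambda _ fun v => measurable_gridIncrement hN h k v

lemma iIndepFun_gridIncrement (hN : ∀ v, IsPoissonProcess (N v) r μ)
    (hind : iIndepFun (fun v ω t => N v t ω) μ) (h : ℝ≥0) :
    iIndepFun (fun (p : V × ℕ) ω => gridIncrement (fun v t => N v t ω) h p.2 p.1) μ := by
  refine iIndepFun_uncurry' (X := fun v k ω => gridIncrement (fun v t => N v t ω) h k v)
    (fun v k => measurable_gridIncrement hN h k v) ?_ ?_
  · refine hind.comp (fun _ (p : ℝ≥0 → ℕ) (k : ℕ) => p ((k + 1 : ℕ) * h) - p (k * h)) fun _ => ?_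
    exact measurable_pi_lambda _ fun k => (measurable_pi_apply _).sub (measurable_pi_apply _)
  · intro v
    refine (hN v).indepIncrements.nat (t := fun k : ℕ => k * h) fun a b hab => ?_
    dsimp only
    gcongr

variable [Fintype V]

lemma measureReal_gridIncrement_eq (hN : ∀ v, IsPoissonProcess (N v) r μ)
    (hind : iIndepFun (fun v ω t => N v t ω) μ) (h : ℝ≥0) (k : ℕ) (c : V → ℕ) :
    μ.real {ω | gridIncrement (fun v t => N v t ω) h k = c} =
      ∏ v, (Real.exp (-(r * h)) * (r * h) ^ c v / (c v).factorial) := by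
  have h1 : iIndepFun (fun v ω => gridIncrement (fun v t => N v t ω) h k v) μ :=
    (iIndepFun_gridIncrement hN hind h).precomp (g := fun v => (v, k))
      fun i j hij => (Prod.mk.inj hij).1
  have h2 : {ω | gridIncrement (fun v t => N v t ω) h k = c} =
      {ω | ∀ v, gridIncrement (fun v t => N v t ω) h k v ∈ ({c v} : Set ℕ)} := by
    ext; simp [funext_iff]
  rw [h2, measureReal_forall_eq_prod h1]
  refine Finset.prod_congr rfl fun v _ => ?_
  have hlaw := (hN v).law (k * h) ((k + 1 : ℕ) * h) (by gcongr; omega)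
  have hsub : ((k + 1 : ℕ) * h - k * h : ℝ≥0) = h := by
    push_cast
    rw [add_mul, one_mul, add_tsub_cancel_left]
  rw [hsub] at hlaw
  have h3 := poissonMeasure_real_singleton (r * h) (c v)
  rw [← hlaw.map_eq, measureReal_def,
    Measure.map_apply_of_aemeasurable hlaw.aemeasurable (measurableSet_singleton _)] at h3
  rw [NNReal.coe_mul] at h3
  exact h3

lemma measureReal_gridIncrement_eq_zero (hN : ∀ v, IsPoissonProcess (N v) r μ)
    (hind : iIndepFun (fun v ω t => N v t ω) μ) (h : ℝ≥0) (k : ℕ) :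
    μ.real {ω | gridIncrement (fun v t => N v t ω) h k = 0} =
      Real.exp (-(Fintype.card V * (r * h))) := by
  rw [measureReal_gridIncrement_eq hN hind]
  simp only [Pi.zero_apply, pow_zero, mul_one, Nat.factorial_zero, Nat.cast_one, div_one,
    Finset.prod_const, Finset.card_univ]
  rw [← Real.exp_nat_mul]
  ring_nf

variable [DecidableEq V]

lemma measureReal_uniquePoint_eq_some (hN : ∀ v, IsPoissonProcess (N v) r μ)
    (hind : iIndepFun (fun v ω t => N v t ω) μ) (h : ℝ≥0) (k : ℕ) (v : V) :
    μ.real {ω | uniquePoint (gridIncrement (fun v t => N v t ω) h k) = some v} =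
      pointWeight V (r * h) (some v) := by
  simp_rw [uniquePoint_eq_some_iff]
  rw [measureReal_gridIncrement_eq hN hind]
  have h1 : ∀ w, Real.exp (-(r * h : ℝ)) * (r * h : ℝ) ^ (Pi.single v 1 : V → ℕ) w /
      ((Pi.single v 1 : V → ℕ) w).factorial =
      Real.exp (-(r * h : ℝ)) * if w = v then (r * h : ℝ) else 1 := by
    intro w
    by_cases hw : w = v
    · subst hw; simp
    · simp [hw]
  rw [Finset.prod_congr rfl fun w _ => h1 w, Finset.prod_mul_distrib, Finset.prod_ite_eq',
    if_pos (Finset.mem_univ v), Finset.prod_const, Finset.card_univ, ← Real.exp_nat_mul,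
    pointWeight]
  ring_nf

lemma measureReal_uniquePoint_eq [IsProbabilityMeasure μ] (hN : ∀ v, IsPoissonProcess (N v) r μ)
    (hind : iIndepFun (fun v ω t => N v t ω) μ) (h : ℝ≥0) (k : ℕ) (o : Option V) :
    μ.real {ω | uniquePoint (gridIncrement (fun v t => N v t ω) h k) = o} =
      pointWeight V (r * h) o := by
  cases o with
  | some v => exact measureReal_uniquePoint_eq_some hN hind h k v
  | none =>
    set ξ : Ω → Option V := fun ω => uniquePoint (gridIncrement (fun v t => N v t ω) h k)
    have hms : ∀ o, MeasurableSet {ω | ξ ω = o} := fun o =>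
      measurable_gridIncrement_pi hN h k (.of_discrete (s := {c | uniquePoint c = o}))
    have h1 : ∑ o, μ.real {ω | ξ ω = o} = 1 := by
      rw [← measureReal_iUnion_fintype (fun a b hab => disjoint_left.2 fun ω ha hb =>
        hab (ha.symm.trans hb)) hms]
      have : (⋃ o, {ω | ξ ω = o}) = univ := by ext; simp
      rw [this, probReal_univ]
    rw [Fintype.sum_option] at h1
    have h2 := sum_pointWeight (V := V) (r * h)
    rw [Fintype.sum_option] at h2
    rw [Finset.sum_congr rfl fun v _ => measureReal_uniquePoint_eq_some hN hind h k v] at h1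
    linarith

lemma measureReal_forall_uniquePoint_eq [IsProbabilityMeasure μ]
    (hN : ∀ v, IsPoissonProcess (N v) r μ)
    (hind : iIndepFun (fun v ω t => N v t ω) μ) (h : ℝ≥0) {m : ℕ} (e : Fin m → Option V) :
    μ.real {ω | ∀ i : Fin m, uniquePoint (gridIncrement (fun v t => N v t ω) h i) = e i} =
      ∏ i, pointWeight V (r * h) (e i) := by
  have h1 : iIndepFun (fun (i : Fin m) ω (v : V) => gridIncrement (fun v t => N v t ω) h i v) μ :=
    iIndepFun_group (Y := fun v (i : Fin m) ω => gridIncrement (fun v t => N v t ω) h i v)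
      (fun v i => measurable_gridIncrement hN h i v)
      ((iIndepFun_gridIncrement hN hind h).precomp (g := fun p : V × Fin m => (p.1, (p.2 : ℕ)))
        fun p q hpq => Prod.ext (Prod.mk.inj hpq).1 (Fin.ext (Prod.mk.inj hpq).2))
  have h2 := measureReal_forall_eq_prod h1 fun i => {c | uniquePoint c = e i}
  refine h2.trans (Finset.prod_congr rfl fun i _ => ?_)
  exact measureReal_uniquePoint_eq hN hind h i (e i)

open Classical in
lemma measureReal_uniquePoint_le_sum [IsProbabilityMeasure μ]
    (hN : ∀ v, IsPoissonProcess (N v) r μ) (hind : iIndepFun (fun v ω t => N v t ω) μ) (h : ℝ≥0)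
    {m : ℕ} (P : (Fin m → Option V) → Prop) :
    μ.real {ω | P fun i => uniquePoint (gridIncrement (fun v t => N v t ω) h i)} ≤
      ∑ e, if P e then ∏ i, pointWeight V (r * h) (e i) else 0 := by
  have h1 : {ω | P fun i => uniquePoint (gridIncrement (fun v t => N v t ω) h i)} ⊆
      ⋃ e ∈ ({e | P e} : Finset (Fin m → Option V)),
        {ω | ∀ i : Fin m, uniquePoint (gridIncrement (fun v t => N v t ω) h i) = e i} := by
    intro ω hω
    simp only [mem_iUnion]
    exact ⟨_, Finset.mem_filter.2 ⟨Finset.mem_univ _, hω⟩, fun i => rfl⟩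
  refine (measureReal_mono h1 (measure_ne_top _ _)).trans
    ((measureReal_biUnion_finset_le _ _).trans_eq ?_)
  rw [Finset.sum_filter]
  refine Finset.sum_congr rfl fun e _ => ?_
  rw [measureReal_forall_uniquePoint_eq hN hind]

/-- With probability `1 - O(h)`, no interval of the grid contains two points. -/
lemma measureReal_exists_multiple_le [IsProbabilityMeasure μ]
    (hN : ∀ v, IsPoissonProcess (N v) r μ) (hind : iIndepFun (fun v ω t => N v t ω) μ) (h : ℝ≥0)
    (m : ℕ) :
    μ.real {ω | ∃ k < m, gridIncrement (fun v t => N v t ω) h k ≠ 0 ∧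
      uniquePoint (gridIncrement (fun v t => N v t ω) h k) = none} ≤
      m * (Fintype.card V * (r * h)) ^ 2 := by
  have hk : ∀ k, μ.real {ω | gridIncrement (fun v t => N v t ω) h k ≠ 0 ∧
      uniquePoint (gridIncrement (fun v t => N v t ω) h k) = none} ≤
      (Fintype.card V * (r * h)) ^ 2 := by
    intro k
    set y : ℝ := Fintype.card V * (r * h) with hy
    have h0 : (uniquePoint (0 : V → ℕ)) = none := by
      cases hu : uniquePoint (0 : V → ℕ) with
      | none => rfl
      | some v =>
        have := congrFun (uniquePoint_eq_some_iff.1 hu) v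
        simp at this
    have h1 : {ω | gridIncrement (fun v t => N v t ω) h k ≠ 0 ∧
        uniquePoint (gridIncrement (fun v t => N v t ω) h k) = none} =
        {ω | uniquePoint (gridIncrement (fun v t => N v t ω) h k) = none} \
          {ω | gridIncrement (fun v t => N v t ω) h k = 0} := by
      ext ω; simp [and_comm]
    have hsub : {ω | gridIncrement (fun v t => N v t ω) h k = 0} ⊆
        {ω | uniquePoint (gridIncrement (fun v t => N v t ω) h k) = none} :=
      fun ω (hω : gridIncrement (fun v t => N v t ω) h k = 0) =>
        (congrArg uniquePoint hω).trans h0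
    have hms : MeasurableSet {ω | gridIncrement (fun v t => N v t ω) h k = 0} :=
      measurable_gridIncrement_pi hN h k (.of_discrete (s := {0}))
    rw [h1, measureReal_sdiff hsub hms (measure_ne_top _ _),
      measureReal_uniquePoint_eq hN hind, measureReal_gridIncrement_eq_zero hN hind, pointWeight,
      ← mul_assoc, ← hy]
    have h2 : 1 - y ≤ Real.exp (-y) := by linarith [Real.add_one_le_exp (-y)]
    have hy0 : 0 ≤ y := by positivity
    nlinarith
  have h1 : {ω | ∃ k < m, gridIncrement (fun v t => N v t ω) h k ≠ 0 ∧
      uniquePoint (gridIncrement (fun v t => N v t ω) h k) = none} =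
      ⋃ k ∈ Finset.range m, {ω | gridIncrement (fun v t => N v t ω) h k ≠ 0 ∧
        uniquePoint (gridIncrement (fun v t => N v t ω) h k) = none} := by
    ext; simp only [mem_ofPred_eq, mem_iUnion, Finset.mem_range, exists_prop]
  rw [h1]
  refine (measureReal_biUnion_finset_le _ _).trans ((Finset.sum_le_sum fun k _ => hk k).trans ?_)
  simp

end Increments

/-! ### The process on the grid -/

section Coupling

variable {K n : ℕ} {F : Finset (Fin 4 → SizeClass K)} {N : (Fin 4 → Fin n) → ℝ≥0 → ℕ}
  {G : ℝ≥0 → SimpleGraph (Fin n)}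

/-- One time step of the chain on the grid; the input `none` has no effect. -/
noncomputable def chainStep (F : Finset (Fin 4 → SizeClass K)) (G : SimpleGraph (Fin n)) :
    Option (Fin 4 → Fin n) → SimpleGraph (Fin n)
  | some v => step F G v
  | none => G

/-- During an interval of the grid with at most one point, the path takes no values other than
those at the two ends of the interval. -/
lemma IsBSRPath.eq_or_eq (hG : IsBSRPath F N G) (hmono : ∀ v, Monotone (N v)) {h : ℝ≥0} {k : ℕ}
    (hk : gridIncrement N h k ≠ 0 → uniquePoint (gridIncrement N h k) ≠ none) {t : ℝ≥0}
    (h1 : k * h ≤ t) (h2 : t ≤ (k + 1 : ℕ) * h) :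
    G t = G (k * h) ∨ G t = G ((k + 1 : ℕ) * h) := by
  have hle1 := fun v => hmono v h1
  have hle2 := fun v => hmono v h2
  by_cases h0 : gridIncrement N h k = 0
  · refine Or.inl (hG.const _ _ h1 fun w => ?_)
    have := congrFun h0 w
    have := hle1 w; have := hle2 w
    simp only [gridIncrement, Pi.zero_apply] at *
    omega
  · obtain ⟨v, hv⟩ := Option.ne_none_iff_exists'.1 (hk h0)
    rw [uniquePoint_eq_some_iff] at hv
    have hw : ∀ w, w ≠ v → N w t = N w (k * h) ∧ N w ((k + 1 : ℕ) * h) = N w t := by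
      intro w hwv
      have := congrFun hv w
      rw [Pi.single_eq_of_ne hwv, gridIncrement] at this
      have := hle1 w; have := hle2 w
      omega
    have hvv := congrFun hv v
    rw [Pi.single_eq_same, gridIncrement] at hvv
    have h3 := hle1 v
    have h4 := hle2 v
    by_cases hc : N v t = N v (k * h)
    · refine Or.inl (hG.const _ _ h1 fun w => ?_)
      by_cases hwv : w = v
      · rw [hwv, hc]
      · exact (hw w hwv).1
    · refine Or.inr (hG.const _ _ h2 fun w => ?_).symm
      by_cases hwv : w = v
      · rw [hwv]; omega
      · exact (hw w hwv).2

lemma IsBSRPath.eq_orbit (hG : IsBSRPath F N G) (hmono : ∀ v, Monotone (N v)) {h : ℝ≥0} {m : ℕ}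
    (hm : ∀ k < m, gridIncrement N h k ≠ 0 → uniquePoint (gridIncrement N h k) ≠ none) {k : ℕ}
    (hk : k ≤ m) :
    G (k * h) = orbit (chainStep F) ⊥ (fun j => uniquePoint (gridIncrement N h j)) k := by
  induction k with
  | zero => simpa [orbit] using hG.init
  | succ k ih =>
    have hle : (k * h : ℝ≥0) ≤ (k + 1 : ℕ) * h := by gcongr; omega
    rw [orbit, ← ih (by omega)]
    have hle1 := fun v => hmono v hle
    by_cases h0 : gridIncrement N h k = 0
    · have hn : uniquePoint (gridIncrement N h k) = none := by
        cases hu : uniquePoint (gridIncrement N h k) with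
        | none => rfl
        | some v =>
          rw [uniquePoint_eq_some_iff, h0] at hu
          have := congrFun hu v
          simp at this
      rw [hn]
      refine hG.const _ _ hle fun w => ?_
      have := congrFun h0 w
      have := hle1 w
      simp only [gridIncrement, Pi.zero_apply] at *
      omega
    · obtain ⟨v, hv⟩ := Option.ne_none_iff_exists'.1 (hm k (by omega) h0)
      rw [hv]
      rw [uniquePoint_eq_some_iff] at hv
      refine hG.jump _ _ hle v ?_ fun w hwv => ?_
      · have := congrFun hv v
        rw [Pi.single_eq_same, gridIncrement] at this
        omega
      · have := congrFun hv w
        rw [Pi.single_eq_of_ne hwv, gridIncrement] at this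
        have := hle1 w
        omega

lemma IsBSRPath.exists_eq_orbit (hG : IsBSRPath F N G) (hmono : ∀ v, Monotone (N v)) {h : ℝ≥0}
    (hh : 0 < h) {m : ℕ}
    (hm : ∀ k < m, gridIncrement N h k ≠ 0 → uniquePoint (gridIncrement N h k) ≠ none) {t : ℝ≥0}
    (ht : t ≤ m * h) :
    ∃ k ≤ m, |(t : ℝ) - k * h| ≤ h ∧
      G t = orbit (chainStep F) ⊥ (fun j => uniquePoint (gridIncrement N h j)) k := by
  rcases ht.eq_or_lt with rfl | ht
  · exact ⟨m, le_rfl, by simp, hG.eq_orbit hmono hm le_rfl⟩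
  · set k := ⌊t / h⌋₊
    have hk1 : k * h ≤ t := (le_div_iff₀ hh).1 (Nat.floor_le zero_le)
    have hk2 : t ≤ (k + 1 : ℕ) * h := by
      push_cast
      exact ((div_lt_iff₀ hh).1 (Nat.lt_floor_add_one (t / h))).le
    have hkm : k < m := by
      have : (k : ℝ≥0) < m := lt_of_mul_lt_mul_right (hk1.trans_lt ht) h.2
      exact_mod_cast this
    have hk1' : (k : ℝ) * h ≤ t := by exact_mod_cast hk1
    have hk2' : (t : ℝ) ≤ (k + 1) * h := by exact_mod_cast hk2
    have hh0 : (0 : ℝ) ≤ h := h.2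
    rcases hG.eq_or_eq hmono (hm k hkm) hk1 hk2 with he | he
    · refine ⟨k, hkm.le, ?_, he.trans (hG.eq_orbit hmono hm hkm.le)⟩
      rw [abs_le]; constructor <;> linarith
    · refine ⟨k + 1, hkm, ?_, he.trans (hG.eq_orbit hmono hm hkm)⟩
      push_cast
      rw [abs_le]; constructor <;> linarith

end Coupling

/-! ### Noise and drift of the chain on the grid -/

section Chain

variable {K n : ℕ} (F : Finset (Fin 4 → SizeClass K))

/-- The mean one-step change of the density of class `i` in the chain on the grid, `x` being the
mean number of points of one process in one interval. -/
noncomputable def chainDrift (x : ℝ) (G : SimpleGraph (Fin n)) (i : SizeClass K) : ℝ :=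
  ∑ o, pointWeight (Fin 4 → Fin n) x o * (density K (chainStep F G o) i - density K G i)

lemma chainDrift_eq (x : ℝ) (G : SimpleGraph (Fin n)) (i : SizeClass K) :
    chainDrift F x G i = x * Real.exp (-((n : ℝ) ^ 4 * x)) *
      ∑ v : Fin 4 → Fin n, (density K (step F G v) i - density K G i) := by
  rw [chainDrift, Fintype.sum_option, Finset.mul_sum]
  simp [chainStep, pointWeight]

lemma abs_chainDrift_sub_le (hn : 1 ≤ n) {B : ℝ}
    (hB : ∀ x ∈ Icc (0 : SizeClass K → ℝ) 1, ‖drift F x‖ ≤ B) {h : ℝ} (hh : 0 ≤ h)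
    (G : SimpleGraph (Fin n)) (i : SizeClass K) :
    |chainDrift F (1 / (2 * (n : ℝ) ^ 3) * h) G i - h * drift F (density K G) i| ≤
      h * (2 * K ^ 2 / n + n * h * B / 2) := by
  have hn0 : (0 : ℝ) < n := by positivity
  have hbox : density K G ∈ Icc (0 : SizeClass K → ℝ) 1 :=
    ⟨fun i => density_nonneg G i, fun i => density_le_one G i⟩
  have hd : |drift F (density K G) i| ≤ B := (norm_le_pi_norm _ i).trans (hB _ hbox)
  have hB0 : 0 ≤ B := (abs_nonneg _).trans hd
  set D := drift F (density K G) i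
  set S := ∑ v : Fin 4 → Fin n, (density K (step F G v) i - density K G i) with hS
  have hSD : |S - 2 * (n : ℝ) ^ 3 * D| ≤ 4 * K ^ 2 * (n : ℝ) ^ 2 :=
    abs_sum_density_step_sub_le F hn G i
  set θ := Real.exp (-((n : ℝ) ^ 4 * (1 / (2 * (n : ℝ) ^ 3) * h))) with hθ
  have e1 : (n : ℝ) ^ 4 * (1 / (2 * (n : ℝ) ^ 3) * h) = n * h / 2 := by field_simp
  have hθ1 : θ ≤ 1 := by
    rw [hθ, e1, Real.exp_le_one_iff]
    have : 0 ≤ n * h / 2 := by positivity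
    linarith
  have hθ0 : 0 ≤ θ := (Real.exp_pos _).le
  have hθ2 : 1 - θ ≤ n * h / 2 := by
    have := Real.add_one_le_exp (-(n * h / 2))
    rw [hθ, e1]; linarith
  have e2 : chainDrift F (1 / (2 * (n : ℝ) ^ 3) * h) G i - h * D =
      θ * (h / (2 * (n : ℝ) ^ 3)) * (S - 2 * (n : ℝ) ^ 3 * D) - h * (1 - θ) * D := by
    rw [chainDrift_eq, ← hθ, ← hS]
    field_simp
    ring
  have h1 : |θ * (h / (2 * (n : ℝ) ^ 3)) * (S - 2 * (n : ℝ) ^ 3 * D)| ≤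
      1 * (h / (2 * (n : ℝ) ^ 3)) * (4 * K ^ 2 * (n : ℝ) ^ 2) := by
    rw [abs_mul, abs_of_nonneg (show 0 ≤ θ * (h / (2 * (n : ℝ) ^ 3)) by positivity)]
    gcongr
  have h2 : |h * (1 - θ) * D| ≤ h * (n * h / 2) * B := by
    rw [abs_mul, abs_of_nonneg (mul_nonneg hh (by linarith))]
    gcongr
  rw [e2]
  refine (abs_sub _ _).trans ((add_le_add h1 h2).trans_eq ?_)
  field_simp
  ring

/-- The inputs `e` make `σ` times the noise of the chain, that is, the compensated sum of the
increments of the density of class `i`, reach `ε` within `m` steps. The quantifier over `e'` only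
extends the inputs beyond the first `m`, which do not matter. -/
def NoiseReaches (h ε σ : ℝ) (m : ℕ) (i : SizeClass K) (e : Fin m → Option (Fin 4 → Fin n)) :
    Prop :=
  ∃ e' : ℕ → Option (Fin 4 → Fin n), (∀ j : Fin m, e' j = e j) ∧ ∃ k ≤ m,
    ε ≤ σ * (density K (orbit (chainStep F) ⊥ e' k) i - density K (⊥ : SimpleGraph (Fin n)) i -
      ∑ j ∈ Finset.range k,
        chainDrift F (1 / (2 * (n : ℝ) ^ 3) * h) (orbit (chainStep F) ⊥ e' j) i)

open Classical in
/-- The noise of the chain is small with high probability; `σ` is a sign. -/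
lemma sum_noiseReaches_le (hn : 1 ≤ n) {h : ℝ} (hh : 0 ≤ h) {l ε σ : ℝ} (hl0 : 0 < l)
    (hl : l * (2 * K / n) ≤ 1) (hσ : |σ| = 1) (m : ℕ) (i : SizeClass K) :
    ∑ e : Fin m → Option (Fin 4 → Fin n), (if NoiseReaches F h ε σ m i e
      then ∏ j, pointWeight (Fin 4 → Fin n) (1 / (2 * (n : ℝ) ^ 3) * h) (e j) else 0) ≤
      Real.exp (-(l * ε) + 2 * K ^ 2 * l ^ 2 * (m * h) / n) := by
  have hn0 : (0 : ℝ) < n := by positivity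
  set x : ℝ := 1 / (2 * (n : ℝ) ^ 3) * h with hx
  have hx0 : 0 ≤ x := by positivity
  have e1 : (n : ℝ) ^ 4 * x = n * h / 2 := by rw [hx]; field_simp
  have hD : ∀ (G : SimpleGraph (Fin n)) o,
      |σ * density K (chainStep F G o) i - σ * density K G i| ≤ 2 * K / n := by
    intro G o
    rw [← mul_sub, abs_mul, hσ, one_mul]
    cases o with
    | none => simp only [chainStep, sub_self, abs_zero]; positivity
    | some v => exact abs_density_step_le F hn G v i
  have hp : ∀ G : SimpleGraph (Fin n), ∑ o, (if σ * density K (chainStep F G o) i -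
      σ * density K G i = 0 then 0 else pointWeight (Fin 4 → Fin n) x o) ≤ n * h / 2 := by
    intro G
    rw [Fintype.sum_option]
    rw [if_pos (by simp [chainStep]), zero_add]
    calc _ ≤ ∑ _v : Fin 4 → Fin n, x := by
          refine Finset.sum_le_sum fun v _ => ?_
          by_cases h0 : σ * density K (chainStep F G (some v)) i -
              σ * density K G i = 0
          · rw [if_pos h0]; exact hx0
          · rw [if_neg h0]
            refine mul_le_of_le_one_right hx0 (Real.exp_le_one_iff.2 ?_)
            exact neg_nonpos.2 (by positivity)
      _ = _ := by simp [← e1]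
  have := sum_exists_compensated_gt_le (fun o => pointWeight_nonneg hx0 o) (sum_pointWeight x)
    (chainStep F) (fun G : SimpleGraph (Fin n) => σ * density K G i) (ε := ε) hD hp (by positivity)
    hl0 hl m ⊥
  refine le_trans (le_of_eq ?_) (this.trans_eq ?_)
  · refine Finset.sum_congr rfl fun e _ => ?_
    unfold NoiseReaches
    refine if_congr (exists_congr fun e' => and_congr_right fun _ => exists_congr fun k =>
      and_congr_right fun _ => ?_) rfl rfl
    rw [mul_sub, mul_sub, Finset.mul_sum]
    simp only [chainDrift, Finset.mul_sum]
    refine iff_of_eq (congrArg₂ _ rfl (congrArg₂ _ rfl (Finset.sum_congr rfl fun j _ =>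
      Finset.sum_congr rfl fun o _ => ?_)))
    ring
  · congr 1
    field_simp

variable {F}

/-- If the noise is at most `ε`, then the chain follows the solution of the differential
equations. -/
lemma abs_density_orbit_sub_le (hn : 1 ≤ n) {x : ℝ → SizeClass K → ℝ} (hx : IsODESolution F x)
    (hbox : ∀ t, 0 ≤ t → x t ∈ Icc (0 : SizeClass K → ℝ) 1) {L B : ℝ≥0}
    (hL : LipschitzOnWith L (drift F) (Icc 0 1))
    (hB : ∀ x ∈ Icc (0 : SizeClass K → ℝ) 1, ‖drift F x‖ ≤ B) {h ε : ℝ} (hh : 0 ≤ h) (hε : 0 ≤ ε)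
    {m : ℕ} {e : ℕ → Option (Fin 4 → Fin n)}
    (hnoise : ∀ i, ∀ k ≤ m,
      |density K (orbit (chainStep F) ⊥ e k) i - density K (⊥ : SimpleGraph (Fin n)) i -
        ∑ j ∈ Finset.range k,
          chainDrift F (1 / (2 * (n : ℝ) ^ 3) * h) (orbit (chainStep F) ⊥ e j) i| ≤ ε)
    {k : ℕ} (hk : k ≤ m) (i : SizeClass K) :
    |density K (orbit (chainStep F) ⊥ e k) i - x (k * h) i| ≤
      (ε + m * (h * (2 * K ^ 2 / n + n * h * B / 2) + L * B * h ^ 2)) *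
        Real.exp (L * (m * h)) := by
  set X : ℕ → SizeClass K → ℝ := fun k => density K (orbit (chainStep F) ⊥ e k) with hX
  have hXbox : ∀ k, X k ∈ Icc (0 : SizeClass K → ℝ) 1 := fun k =>
    ⟨fun i => density_nonneg _ i, fun i => density_le_one _ i⟩
  have hybox : ∀ k : ℕ, x (k * h) ∈ Icc (0 : SizeClass K → ℝ) 1 := fun k =>
    hbox _ (by positivity)
  have h0 : X 0 = x ((0 : ℕ) * h) := by
    funext i
    have hc : ∀ v : Fin n, vertexClass K (⊥ : SimpleGraph (Fin n)) v = sizeClass K 1 := by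
      intro v
      have : ((⊥ : SimpleGraph (Fin n)).connectedComponentMk v).supp = {v} := by
        ext w
        rw [mem_supp_iff, SimpleGraph.reachable_bot, mem_singleton_iff]
      rw [vertexClass, this, ncard_singleton]
    have hn0 : (n : ℝ) ≠ 0 := by positivity
    simp only [hX, orbit, density, hc, Nat.cast_zero, zero_mul, hx.init]
    by_cases hi : i = sizeClass K 1
    · simp [hi, hn0]
    · simp [hi, Ne.symm hi]
  have hη : 0 ≤ h * (2 * K ^ 2 / n + n * h * B / 2) := by positivity
  refine (norm_le_pi_norm (X k - x (k * h)) i).trans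
    (norm_sub_le_of_perturbed_euler (g := drift F) (X := X) (y := fun k => x (k * h))
      (b := fun k => chainDrift F (1 / (2 * (n : ℝ) ^ 3) * h) (orbit (chainStep F) ⊥ e k))
      hh L.2 hε hη (by positivity) h0 ?_ ?_ ?_ ?_ hk)
  · intro k hk
    refine (pi_norm_le_iff_of_nonneg hε).2 fun i => ?_
    have := hnoise i k hk
    simpa [hX, orbit] using this
  · exact fun k => (pi_norm_le_iff_of_nonneg hη).2 fun i =>
      abs_chainDrift_sub_le F hn hB hh _ i
  · intro k
    have e1 : ((k + 1 : ℕ) : ℝ) * h = k * h + h := by push_cast; ring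
    rw [e1]
    exact hx.norm_euler_step_le (fun t ht => hB _ (hbox t ht)) hbox hL (by positivity) hh
  · exact fun k => hL.norm_sub_le (hXbox k) (hybox k)

/-- The probability of a large deviation, for a grid of mesh `h` and a free parameter `l`. -/
lemma measureReal_deviation_le (hn : 1 ≤ n) {Ω : Type*} [MeasurableSpace Ω] {μ : Measure Ω}
    [IsProbabilityMeasure μ] {N : (Fin 4 → Fin n) → ℝ≥0 → Ω → ℕ}
    {G : ℝ≥0 → Ω → SimpleGraph (Fin n)} (hG : IsBSRProcess F μ N G)
    {x : ℝ → SizeClass K → ℝ} (hx : IsODESolution F x)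
    (hbox : ∀ t, 0 ≤ t → x t ∈ Icc (0 : SizeClass K → ℝ) 1) {L B : ℝ≥0}
    (hL : LipschitzOnWith L (drift F) (Icc 0 1))
    (hB : ∀ x ∈ Icc (0 : SizeClass K → ℝ) 1, ‖drift F x‖ ≤ B) {h : ℝ≥0} (hh : 0 < h) {ε l : ℝ}
    (hε : 0 ≤ ε) (hl0 : 0 < l) (hl : l * (2 * K / n) ≤ 1) (m : ℕ) :
    μ.real {ω | ∃ (i : SizeClass K) (t : ℝ≥0), t ≤ m * h ∧
      (ε + m * (h * (2 * K ^ 2 / n + n * h * B / 2) + L * B * h ^ 2)) * Real.exp (L * (m * h)) +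
        B * h < |density K (G t ω) i - x t i|} ≤
      m * (n * h / 2) ^ 2 +
        2 * (K + 1) * Real.exp (-(l * ε) + 2 * K ^ 2 * l ^ 2 * (m * h) / n) := by
  classical
  have hn0 : (0 : ℝ) < n := by positivity
  set A : ℝ := (ε + m * (h * (2 * K ^ 2 / n + n * h * B / 2) + L * B * h ^ 2)) *
    Real.exp (L * (m * h))
  set R : ℝ := Real.exp (-(l * ε) + 2 * K ^ 2 * l ^ 2 * (m * h) / n) with hR
  set ξ : Ω → ℕ → Option (Fin 4 → Fin n) := fun ω k =>
    uniquePoint (gridIncrement (fun v t => N v t ω) h k)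
  set multi : Set Ω := {ω | ∃ k < m, gridIncrement (fun v t => N v t ω) h k ≠ 0 ∧
    uniquePoint (gridIncrement (fun v t => N v t ω) h k) = none} with hmulti
  set noise : ℝ → SizeClass K → Set Ω := fun σ i =>
    {ω | NoiseReaches F h ε σ m i fun j : Fin m => ξ ω j}
  have hr : ((1 / (2 * (n : ℝ≥0) ^ 3) : ℝ≥0) : ℝ) = 1 / (2 * (n : ℝ) ^ 3) := by push_cast; rfl
  have hmultile : μ.real multi ≤ m * (n * h / 2) ^ 2 := by
    refine (measureReal_exists_multiple_le hG.poisson hG.indep h m).trans_eq ?_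
    rw [hr]
    have : ((Fintype.card (Fin 4 → Fin n) : ℕ) : ℝ) = (n : ℝ) ^ 4 := by simp
    rw [this]
    field_simp
  have hnoisele : ∀ σ : ℝ, |σ| = 1 → ∀ i, μ.real (noise σ i) ≤ R := by
    intro σ hσ i
    refine (measureReal_uniquePoint_le_sum hG.poisson hG.indep h
      (NoiseReaches F h ε σ m i)).trans ?_
    rw [hr]
    exact sum_noiseReaches_le F hn h.2 hl0 hl hσ m i
  have hae : ∀ᵐ ω ∂μ, IsBSRPath F (fun v t => N v t ω) (fun t => G t ω) ∧
      ∀ v, Monotone fun t => N v t ω :=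
    hG.path.and (ae_all_iff.2 fun v => (hG.poisson v).monotone)
  have hsub : {ω | ∃ (i : SizeClass K) (t : ℝ≥0), t ≤ m * h ∧
      A + B * h < |density K (G t ω) i - x t i|} ≤ᵐ[μ]
      (multi ∪ ⋃ i, (noise 1 i ∪ noise (-1) i) : Set Ω) := by
    filter_upwards [hae] with ω ⟨hpath, hmono⟩
    rintro ⟨i, t, ht, hgt⟩
    by_contra hnot
    have hnm : ω ∉ multi := fun h => hnot (Or.inl h)
    have hnn : ∀ σ : ℝ, σ = 1 ∨ σ = -1 → ∀ i, ω ∉ noise σ i := by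
      rintro σ (rfl | rfl) i hi
      · exact hnot (Or.inr (mem_iUnion.2 ⟨i, Or.inl hi⟩))
      · exact hnot (Or.inr (mem_iUnion.2 ⟨i, Or.inr hi⟩))
    have hgood : ∀ k < m, gridIncrement (fun v t => N v t ω) h k ≠ 0 →
        uniquePoint (gridIncrement (fun v t => N v t ω) h k) ≠ none :=
      fun k hk h0 h1 => hnm ⟨k, hk, h0, h1⟩
    have hsmall : ∀ i, ∀ k ≤ m,
        |density K (orbit (chainStep F) ⊥ (ξ ω) k) i - density K (⊥ : SimpleGraph (Fin n)) i -
          ∑ j ∈ Finset.range k,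
            chainDrift F (1 / (2 * (n : ℝ) ^ 3) * h) (orbit (chainStep F) ⊥ (ξ ω) j) i| ≤ ε := by
      intro i k hk
      by_contra hgt
      rw [not_le, lt_abs] at hgt
      rcases hgt with hgt | hgt
      · exact hnn 1 (Or.inl rfl) i ⟨ξ ω, fun _ => rfl, k, hk, by linarith⟩
      · exact hnn (-1) (Or.inr rfl) i ⟨ξ ω, fun _ => rfl, k, hk, by linarith⟩
    obtain ⟨k, hk, htk, hGt⟩ := hpath.exists_eq_orbit hmono hh hgood ht
    have h1 := abs_density_orbit_sub_le hn hx hbox hL hB h.2 hε hsmall hk i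
    have h2 : |x (k * h) i - x t i| ≤ B * h := by
      have hkh : (0 : ℝ) ≤ k * h := by positivity
      have hB' := fun t ht => hB _ (hbox t ht)
      refine (norm_le_pi_norm (x (k * h) - x t) i).trans ?_
      rcases le_total (t : ℝ) (k * h) with hle | hle
      · refine (hx.norm_sub_le hB' t.2 hle).trans ?_
        rw [abs_sub_comm] at htk
        gcongr
        exact (le_abs_self _).trans htk
      · rw [norm_sub_rev]
        refine (hx.norm_sub_le hB' hkh hle).trans ?_
        gcongr
        exact (le_abs_self _).trans htk
    rw [hGt] at hgt
    have h3 := abs_sub_le (density K (orbit (chainStep F) ⊥ (ξ ω) k) i) (x (k * h) i) (x t i)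
    exact absurd (h3.trans (add_le_add h1 h2)) (not_le.2 hgt)
  calc _ ≤ μ.real (multi ∪ ⋃ i, (noise 1 i ∪ noise (-1) i)) :=
        ENNReal.toReal_mono (measure_ne_top _ _) (measure_mono_ae hsub)
    _ ≤ μ.real multi + ∑ i, μ.real (noise 1 i ∪ noise (-1) i) :=
        (measureReal_union_le _ _).trans (by gcongr; exact measureReal_iUnion_fintype_le _)
    _ ≤ m * (n * h / 2) ^ 2 + ∑ _i : SizeClass K, (R + R) := by
        gcongr with i
        exact (measureReal_union_le _ _).trans
          (add_le_add (hnoisele 1 (by simp) i) (hnoisele (-1) (by simp) i))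
    _ = _ := by
        simp only [Finset.sum_const, Finset.card_univ, Fintype.card_option, Fintype.card_fin,
          nsmul_eq_mul]
        push_cast
        ring

end Chain

end BoundedSize

theorem lemma4p2 (K : ℕ) (hK : 1 ≤ K) (F : Finset (Fin 4 → BoundedSize.SizeClass K)) :
    ∃ x : ℝ → BoundedSize.SizeClass K → ℝ,
      BoundedSize.IsODESolution F x ∧
      (∀ y, BoundedSize.IsODESolution F y → ∀ t, 0 ≤ t → y t = x t) ∧
      ∀ δ T : ℝ, 0 < δ → δ < 1 / 2 → 0 < T →
        ∃ C₁ C₂ : ℝ, 0 < C₁ ∧ 0 < C₂ ∧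
          ∀ n : ℕ, 1 ≤ n →
          ∀ (Ω : Type*) [MeasurableSpace Ω] (μ : Measure Ω) [IsProbabilityMeasure μ]
            (N : (Fin 4 → Fin n) → ℝ≥0 → Ω → ℕ) (G : ℝ≥0 → Ω → SimpleGraph (Fin n)),
            BoundedSize.IsBSRProcess F μ N G →
            μ.real {ω | (n : ℝ) ^ (-δ) < ⨆ i : BoundedSize.SizeClass K,
                ⨆ t : {t : ℝ≥0 // (t : ℝ) ≤ T}, |BoundedSize.density K (G t ω) i - x t i|} <
              C₁ * Real.exp (-C₂ * (n : ℝ) ^ (1 - 2 * δ)) := by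
  open BoundedSize in
  obtain ⟨x, hx, hbox⟩ := exists_isODESolution F
  refine ⟨x, hx, fun y hy t ht => hx.unique hy ht, fun δ T hδ hδ2 hT => ?_⟩
  obtain ⟨L, hL⟩ := exists_lipschitzOnWith_drift F (isCompact_Icc (a := 0) (b := 1))
  obtain ⟨B, hB⟩ := exists_norm_drift_le F (isCompact_Icc (a := 0) (b := 1))
  have hKr : (1 : ℝ) ≤ K := by exact_mod_cast hK
  set κ : ℝ := 1 / (4 * K ^ 2 * T + 2 * K) with hκ
  have hκ0 : 0 < κ := by positivity
  set E : ℝ := Real.exp (L * T) with hE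
  have hE0 : 0 < E := Real.exp_pos _
  have hE1 : 1 ≤ E := Real.one_le_exp (by positivity)
  set C₂ : ℝ := κ / (32 * E ^ 2) with hC₂
  have hC₂0 : 0 < C₂ := by positivity
  -- for `n ≥ A ^ 2` the deterministic error of order `1 / n` is below `n ^ (-δ) / 4`
  set A : ℝ := 8 * T * K ^ 2 * E with hA
  refine ⟨2 * K + 4 + Real.exp (C₂ * A ^ 2), C₂, by positivity, hC₂0, ?_⟩
  intro n hn Ω _ μ _ N G hG
  have hn1 : (1 : ℝ) ≤ n := by exact_mod_cast hn
  have hn0 : (0 : ℝ) < n := by positivity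
  rcases lt_or_ge (n : ℝ) (A ^ 2) with hnA | hnA
  · -- for small `n` the bound exceeds `1`
    have h1 : (n : ℝ) ^ (1 - 2 * δ) ≤ n := by
      calc (n : ℝ) ^ (1 - 2 * δ) ≤ (n : ℝ) ^ (1 : ℝ) :=
            Real.rpow_le_rpow_of_exponent_le hn1 (by linarith)
        _ = n := Real.rpow_one _
    have h2 : C₂ * (n : ℝ) ^ (1 - 2 * δ) ≤ C₂ * A ^ 2 := by gcongr; linarith
    have h3 : Real.exp (C₂ * A ^ 2) * Real.exp (-C₂ * (n : ℝ) ^ (1 - 2 * δ)) ≥ 1 := by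
      rw [← Real.exp_add]
      exact Real.one_le_exp (by linarith)
    have h4 : 0 < (2 * K + 4) * Real.exp (-C₂ * (n : ℝ) ^ (1 - 2 * δ)) := by positivity
    calc _ ≤ (1 : ℝ) := measureReal_le_one
      _ < _ := by rw [add_mul]; linarith
  set u : ℝ := (n : ℝ) ^ (-δ) with hu
  have hu0 : 0 < u := Real.rpow_pos_of_pos hn0 _
  have hu1 : u ≤ 1 := Real.rpow_le_one_of_one_le_of_nonpos hn1 (by linarith)
  have hnu : (n : ℝ) * u ^ 2 = (n : ℝ) ^ (1 - 2 * δ) := by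
    rw [hu, ← Real.rpow_natCast ((n : ℝ) ^ (-δ)), ← Real.rpow_mul hn0.le]
    nth_rewrite 1 [← Real.rpow_one (n : ℝ)]
    rw [← Real.rpow_add hn0]
    congr 1; push_cast; ring
  have hAnu : A ≤ n * u := by
    have h1 : (n : ℝ) * u = (n : ℝ) ^ (1 - δ) := by
      rw [hu]
      nth_rewrite 1 [← Real.rpow_one (n : ℝ)]
      rw [← Real.rpow_add hn0]
      congr 1
    rw [h1]
    calc A ≤ Real.sqrt n := Real.le_sqrt_of_sq_le hnA
      _ = (n : ℝ) ^ (1 / 2 : ℝ) := Real.sqrt_eq_rpow _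
      _ ≤ _ := Real.rpow_le_rpow_of_exponent_le hn1 (by linarith)
  set ε : ℝ := u / (4 * E) with hε
  have hε0 : 0 < ε := by positivity
  have hε1 : ε ≤ 1 := by
    rw [hε, div_le_one (by positivity)]; linarith
  set l : ℝ := κ * n * ε with hl
  have hl0 : 0 < l := by positivity
  have hlc : l * (2 * K / n) ≤ 1 := by
    have h1 : l * (2 * K / n) = 2 * K * κ * ε := by rw [hl]; field_simp
    have h2 : 2 * K * κ ≤ 1 := by
      rw [hκ, mul_one_div, div_le_one (by positivity)]
      have : 0 ≤ 4 * (K : ℝ) ^ 2 * T := by positivity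
      linarith
    rw [h1]
    exact mul_le_one₀ h2 hε0.le hε1
  have hexp : -(l * ε) + 2 * K ^ 2 * l ^ 2 * T / n ≤ -C₂ * (n : ℝ) ^ (1 - 2 * δ) := by
    have h1 : 2 * K ^ 2 * κ * T ≤ 1 / 2 := by
      rw [hκ, mul_one_div, div_mul_eq_mul_div, div_le_iff₀ (by positivity)]
      linarith
    have h2 : -(l * ε) + 2 * K ^ 2 * l ^ 2 * T / n =
        -(κ * n * ε ^ 2) * (1 - 2 * K ^ 2 * κ * T) := by
      rw [hl]; field_simp; ring
    have h3 : κ * n * ε ^ 2 = 2 * C₂ * (n : ℝ) ^ (1 - 2 * δ) := by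
      rw [← hnu, hε, hC₂]; field_simp; norm_num
    have h4 : 0 < κ * n * ε ^ 2 := by positivity
    rw [h2]
    nlinarith
  -- a grid of `m` intervals, fine enough that all errors due to the discretization are negligible
  set D : ℝ := (T * n * T * B / 2 + L * B * T ^ 2) * E + B * T with hD
  have hD0 : 0 ≤ D := by positivity
  set R : ℝ := Real.exp (-C₂ * (n : ℝ) ^ (1 - 2 * δ)) with hR
  have hR0 : 0 < R := Real.exp_pos _
  obtain ⟨m, hm⟩ := exists_nat_ge (max 1 (max (2 * D / u) ((n * T / 2) ^ 2 / R)))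
  have hm1 : (1 : ℝ) ≤ m := (le_max_left _ _).trans hm
  have hmD : 2 * D / u ≤ m := (le_max_left _ _).trans ((le_max_right _ _).trans hm)
  have hmR : (n * T / 2) ^ 2 / R ≤ m := (le_max_right _ _).trans ((le_max_right _ _).trans hm)
  have hm0 : (0 : ℝ) < m := by linarith
  have hm0' : (0 : ℝ≥0) < m := by exact_mod_cast hm0
  set h : ℝ≥0 := T.toNNReal / m with hh
  have hhT : (h : ℝ) = T / m := by rw [hh]; push_cast; rw [Real.coe_toNNReal _ hT.le]
  have hh0 : 0 < h := div_pos (Real.toNNReal_pos.2 hT) hm0'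
  have hmh : (m : ℝ) * h = T := by rw [hhT]; field_simp
  have hmain := measureReal_deviation_le hn hG hx hbox hL hB hh0 hε0.le hl0 hlc m
  rw [hmh] at hmain
  have herr : (ε + m * (h * (2 * K ^ 2 / n + n * h * B / 2) + L * B * (h : ℝ) ^ 2)) *
      Real.exp (L * T) + B * h ≤ u := by
    have h1 : (ε + m * (h * (2 * K ^ 2 / n + n * h * B / 2) + L * B * (h : ℝ) ^ 2)) *
        Real.exp (L * T) + B * h = u / 4 + A / (4 * n) + D / m := by
      rw [← hE, hhT, hε, hA, hD]
      field_simp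
      ring
    have h2 : A / (4 * n) ≤ u / 4 := by
      rw [div_le_iff₀ (by positivity)]
      linarith
    have h3 : D / m ≤ u / 2 := by
      rw [div_le_iff₀ hu0] at hmD
      rw [div_le_iff₀ hm0]
      linarith
    rw [h1]; linarith
  have hsub : {ω | u < ⨆ i : SizeClass K,
      ⨆ t : {t : ℝ≥0 // (t : ℝ) ≤ T}, |density K (G t ω) i - x t i|} ⊆
      {ω | ∃ (i : SizeClass K) (t : ℝ≥0), t ≤ m * h ∧
        (ε + m * (h * (2 * K ^ 2 / n + n * h * B / 2) + L * B * (h : ℝ) ^ 2)) *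
          Real.exp (L * T) + B * h < |density K (G t ω) i - x t i|} := by
    intro ω hω
    change u < iSup _ at hω
    have : Nonempty {t : ℝ≥0 // (t : ℝ) ≤ T} := ⟨⟨0, hT.le⟩⟩
    obtain ⟨i, hi⟩ := exists_lt_of_lt_ciSup hω
    obtain ⟨t, ht⟩ := exists_lt_of_lt_ciSup hi
    refine ⟨i, t, ?_, herr.trans_lt ht⟩
    rw [← NNReal.coe_le_coe]
    push_cast
    rw [hmh]
    exact t.2
  calc _ ≤ _ := measureReal_mono hsub (measure_ne_top _ _)
    _ ≤ _ := hmain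
    _ ≤ R + 2 * (K + 1) * R := by
      gcongr
      · rw [div_le_iff₀ hR0] at hmR
        have : (m : ℝ) * (n * h / 2) ^ 2 = (n * T / 2) ^ 2 / m := by rw [hhT]; field_simp
        rw [this, div_le_iff₀ hm0]
        linarith
      · exact Real.exp_le_exp.2 hexp
    _ < (2 * K + 4 + Real.exp (C₂ * A ^ 2)) * R := by
      have : 0 < Real.exp (C₂ * A ^ 2) * R := by positivity
      linarith
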